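/- \textbf{Model.} Let $n,m\in\mathbb{N}$, let $[n]$ be the server types and $[m]$ the customer types, and let $E\subseteq[n]\times[m]$ be the set of compatible pairs. Let $\lambda^{\max}_j\ge 0$ and $\mu^{\max}_i\ge 0$ be the largest possible arrival rates and $s\ge 0$ the holding cost per waiting customer or server per unit of time. The demand curves $F_j$ (price as a function of the arrival rate of type $j$ customers) are strictly decreasing and twice continuously differentiable on $(0,\lambda^{\max}_j]$, the supply curves $G_i$ are strictly increasing and twice continuously differentiable on $(0,\mu^{\max}_i]$; the revenue functions $r\mapsto rF_j(r)$ are concave on $[0,\lambda^{\max}_j]$ and the cost functions $r\mapsto rG_i(r)$ are convex on $[0,\mu^{\max}_i]$, both being $0$ at $r=0$ (so that prices at rate $0$ may be infinite). A state $q\in\mathbb{Z}_+^{n+m}$ lists the queue lengths $q^{(1)}_i$ of servers and $q^{(2)}_j$ of customers. Let $X(q)$ be the set of $x\in\mathbb{Z}_+^{n\times m}$ with $\sum_i x_{ij}\le q^{(2)}_j$, $\sum_j x_{ij}\le q^{(1)}_i$, and $x_{ij}=0$ for $(i,j)\notin E$. A (stationary) pricing and matching policy chooses for each state $q$ arrival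 rates $\lambda_j(q)\in[0,\lambda^{\max}_j]$, $\mu_i(q)\in[0,\mu^{\max}_i]$ and, for each type $k$ of arrival in state $q$, a matching $x(q,k)\in X(q+e_k)$, where $e_k$ is the unit vector of the arriving type. It induces a continuous-time Markov chain on $\mathbb{Z}_+^{n+m}$: from $q$, for each type $k$, at rate $\lambda_j(q)$ if $k$ is customer type $j$ and $\mu_i(q)$ if $k$ is server type $i$, the chain jumps to $q+e_k$ minus the customers and servers matched by $x(q,k)$. The policy is \emph{stable} if the communicating class of this chain that contains the empty state $0$ is positive recurrent. The expected profit rate in state $q$ is $$R(q)=\sum_{j} F_j(\lambda_j(q))\lambda_j(q)-\sum_i G_i(\mu_i(q))\mu_i(q)-s\Big(\sum_i q^{(1)}_i+\sum_j q^{(2)}_j\Big),$$ and the long-run expected profit rate from the initial state $q_0$ is $\limsup_{T\to\infty}\frac1T\int_0^T\mathbb{E}_{q_0}[R(q(t))]\,dt\in[-\infty,\infty]$. \textbf{Fluid problem.} Let $$\pi^*=\sup\ \sum_j F_j(\tilde\lambda_j)\tilde\lambda_j-\sum_i G_i(\tilde\mu_i)\tilde\mu_i$$ over all $\tilde\lambda_j\in[0,\lambda^{\max}_j]$,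 $\tilde\mu_i\in[0,\mu^{\max}_i]$ and $\chi\in\mathbb{R}^{n\times m}$ with $\tilde\lambda_j=\sum_i\chi_{ij}$ for all $j$, $\tilde\mu_i=\sum_j\chi_{ij}$ for all $i$, $\chi_{ij}=0$ for $(i,j)\notin E$ and $\chi_{ij}\ge0$ for $(i,j)\in E$. \textbf{Proposition.} The supremum $\pi^*$ is finite, and for every stable pricing and matching policy and every initial state $q_0$ in the communicating class of $0$ (in particular $q_0=0$), the long-run expected profit rate from $q_0$ is at most $\pi^*$. -/

import Mathlib

open Set Filter Topology
open scoped ENNReal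

noncomputable section

namespace TwoSided

/-- Data of a two-sided queueing system with `n` server types and `m` customer types. -/
structure System (n m : ℕ) where
  /-- `edge i j`: a type `i` server can serve a type `j` customer. -/
  edge : Fin n → Fin m → Prop
  /-- Demand curves: `F j r` is the price at which type `j` customers arrive at rate `r`. -/
  F : Fin m → ℝ → ℝ
  /-- Supply curves: `G i r` is the price at which type `i` servers arrive at rate `r`. -/
  G : Fin n → ℝ → ℝ
  /-- Largest possible arrival rates of the customer types. -/
  lamMax : Fin m → ℝ
  /-- Largest possible arrival rates of the server types. -/
  muMax : Fin n → ℝ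
  /-- Holding cost per waiting customer or server and per unit of time. -/
  s : ℝ

/-- A type of arrival: a server type `Sum.inl i` or a customer type `Sum.inr j`. -/
abbrev Arrival (n m : ℕ) : Type := Fin n ⊕ Fin m

/-- The state space: the queue lengths of all server and customer types. -/
abbrev State (n m : ℕ) : Type := Arrival n m → ℕ

/-- Numbers `x i j` of type `i` servers matched to type `j` customers. -/
abbrev Matching (n m : ℕ) : Type := Fin n → Fin m → ℕ

/-- The number of departures from each queue caused by a matching. -/
def departures {n m : ℕ} (x : Matching n m) : State n m :=
  Sum.elim (fun i => ∑ j, x i j) (fun j => ∑ i, x i j)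

namespace System

variable {n m : ℕ} (M : System n m)

/-- The set `X(q)` of matchings that are possible at queue lengths `q`. -/
def feasibleMatchings (q : State n m) : Set (Matching n m) :=
  {x | (∀ j, ∑ i, x i j ≤ q (Sum.inr j)) ∧ (∀ i, ∑ j, x i j ≤ q (Sum.inl i)) ∧
    ∀ i j, ¬ M.edge i j → x i j = 0}

/-- The queue lengths right after an arrival of type `k`, before any matching. -/
def afterArrival (q : State n m) (k : Arrival n m) : State n m := q + Pi.single k 1

/-- A (stationary) pricing and matching policy. In state `q` the prices are such that customers
and servers arrive at rates `lam q j` and `mu q i`; when an arrival of type `k` finds the queue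
lengths `q`, the pairs `matching q k` are matched at once and leave. -/
structure Policy where
  lam : State n m → Fin m → ℝ
  mu : State n m → Fin n → ℝ
  matching : State n m → Arrival n m → Matching n m
  lam_mem : ∀ q j, lam q j ∈ Icc 0 (M.lamMax j)
  mu_mem : ∀ q i, mu q i ∈ Icc 0 (M.muMax i)
  matching_mem : ∀ q k, matching q k ∈ M.feasibleMatchings (afterArrival q k)

namespace Policy

variable {M} (P : M.Policy)

/-- The rate of arrivals of type `k` in state `q`. -/
def rate (q : State n m) : Arrival n m → ℝ := Sum.elim (P.mu q) (P.lam q)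

/-- The state after an arrival of type `k` in state `q` and the matching that follows it. The
subtraction never truncates, since the matching is feasible. -/
def next (q : State n m) (k : Arrival n m) : State n m :=
  afterArrival q k - departures (P.matching q k)

/-- The generator of the continuous-time Markov chain induced by the policy: from `q` the chain
jumps to `next q k` at rate `rate q k`, for each arrival type `k`. -/
def generator (f : State n m → ℝ) (q : State n m) : ℝ :=
  ∑ k, P.rate q k * (f (P.next q k) - f q)

/-- The transition probabilities of the induced chain: `transProb t q y` is the `(q, y)` entry of
the exponential `e^{tA}` of the (bounded) generator `A`. -/
def transProb (t : ℝ) (q y : State n m) : ℝ :=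
  ∑' l : ℕ, t ^ l / (l.factorial : ℝ) * (P.generator^[l] (Pi.single y 1)) q

/-- The total rate at which the chain leaves the state `q`. -/
def exitRate (q : State n m) : ℝ := ∑ k, P.rate q k

/-- `timeToEnter z l q` is the expected time that the chain started in `q` spends, during its
first `l` sojourns, before it first jumps into `z` (conditioning on the first jump: the sojourn in
`q` has mean `1 / exitRate q`, and the chain then jumps to `next q k` with probability
`rate q k / exitRate q`; a sojourn in an absorbing state lasts forever). -/
def timeToEnter (z : State n m) : ℕ → State n m → ℝ≥0∞
  | 0, _ => 0
  | l + 1, q => (ENNReal.ofReal (P.exitRate q))⁻¹ +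
      ∑ k, ENNReal.ofReal (P.rate q k) / ENNReal.ofReal (P.exitRate q) *
        (if P.next q k = z then 0 else timeToEnter z l (P.next q k))

/-- The expected time until the chain started in `z` first returns to `z` after leaving it. -/
def meanReturnTime (z : State n m) : ℝ≥0∞ := ⨆ l : ℕ, P.timeToEnter z l z

/-- Positive recurrence of a state: it is absorbing or has a finite mean return time. -/
def PositiveRecurrent (z : State n m) : Prop :=
  P.exitRate z = 0 ∨ P.meanReturnTime z < ∞

/-- `y` is accessible from `q`. -/
def Accessible (q y : State n m) : Prop :=
  Relation.ReflTransGen (fun a b => ∃ k, 0 < P.rate a k ∧ b = P.next a k) q y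

/-- The communicating class of the empty state. -/
def zeroClass : Set (State n m) := {q | P.Accessible 0 q ∧ P.Accessible q 0}

/-- Stability: the communicating class that contains the empty state is positive recurrent. -/
def Stable : Prop := ∀ q ∈ P.zeroClass, P.PositiveRecurrent q

/-- The expected profit per unit of time in state `q`: customers pay and servers are paid the
current prices on arrival, and there is a holding cost for everyone who waits. -/
def profitRate (q : State n m) : ℝ :=
  ∑ j, M.F j (P.lam q j) * P.lam q j - ∑ i, M.G i (P.mu q i) * P.mu q i - M.s * ∑ k, (q k : ℝ)

/-- The expected profit rate at time `t` of the chain started in `q₀`. -/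
def expectedProfitRate (q₀ : State n m) (t : ℝ) : ℝ :=
  ∑' y, P.transProb t q₀ y * P.profitRate y

/-- The long-run average expected profit of the chain started in `q₀` (an upper limit, so that it
is defined for every policy; it may be `-∞`). -/
def longRunProfit (q₀ : State n m) : EReal :=
  limsup (fun T : ℝ => (((∫ t in (0 : ℝ)..T, P.expectedProfitRate q₀ t) / T : ℝ) : EReal)) atTop

end Policy

/-- The feasible points `(lam, mu, chi)` of the fluid problem. -/
def fluidFeasible : Set ((Fin m → ℝ) × (Fin n → ℝ) × (Fin n → Fin m → ℝ)) :=
  {v | (∀ j, v.1 j ∈ Icc 0 (M.lamMax j)) ∧ (∀ i, v.2.1 i ∈ Icc 0 (M.muMax i)) ∧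
    (∀ j, v.1 j = ∑ i, v.2.2 i j) ∧ (∀ i, v.2.1 i = ∑ j, v.2.2 i j) ∧
    (∀ i j, ¬ M.edge i j → v.2.2 i j = 0) ∧ (∀ i j, M.edge i j → 0 ≤ v.2.2 i j)}

/-- The objective of the fluid problem. -/
def fluidObjective (v : (Fin m → ℝ) × (Fin n → ℝ) × (Fin n → Fin m → ℝ)) : ℝ :=
  ∑ j, M.F j (v.1 j) * v.1 j - ∑ i, M.G i (v.2.1 i) * v.2.1 i

/-- The optimal value of the fluid problem. -/
def fluidValue : ℝ := sSup (M.fluidObjective '' M.fluidFeasible)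

end System

end TwoSided

end

namespace TwoSided

/-! Averaged over time, the arrival rates and the rates of matches nearly form a feasible flow of
the fluid problem. By Jensen's inequality the averaged profit is at most the revenue at the averaged
rates, and holding costs only lower it. All this is done for the uniformized chain `step`, whose
laws at finite times have finite support.

The averaged flow misses balance by the mean drift of the queues, which telescopes to a multiple of
(E q_a(L) - q_a(0)) / L (`avg_balance`, `avg_generator`). Positive recurrence makes this vanish: the
occupation measure of one excursion from `z` is subinvariant and so dominates, up to a factor, every
law of the chain started in `z`. Hence these laws are tight (`exists_step_pow_tail_le`), and as the
total queue grows by at most one per step, its mean is sublinear (`exists_step_pow_size_le`).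

Passing to the limit inside the revenues is not possible, since concave functions may jump at the
ends of the interval. Instead, mixing in a small flow on the pairs that can really be matched
repairs the imbalance exactly, and concavity controls the loss
(`exists_sum_revenue_le_of_nearly_balanced`). Types in no such pair cannot be repaired, but in the
recurrent class they never arrive (`rate_eq_zero_of_liveDegree`).

Finally, the continuous-time law is a Poisson mixture of the laws of the uniformized chain, so
linear bounds on accumulated profit carry over (`longRunProfit_le`). -/

/-- The total number of waiting customers and servers. -/
def size {n m : ℕ} (q : State n m) : ℕ := ∑ a, q a

/-- The row and column sums of a matrix of rates of matches. -/
def load {n m : ℕ} (χ : Fin n → Fin m → ℝ) : Arrival n m → ℝ :=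
  Sum.elim (fun i => ∑ j, χ i j) (fun j => ∑ i, χ i j)

namespace System

variable {n m : ℕ} (M : System n m)

/-- The largest possible rate of each type of arrival. -/
def rateMax : Arrival n m → ℝ := Sum.elim M.muMax M.lamMax

/-- A rate that is larger than the exit rates of all states under all policies. -/
noncomputable def uniformRate : ℝ := ∑ a, M.rateMax a + 1

/-- The profit per unit of time earned from arrivals of a given type. -/
def revenue : Arrival n m → ℝ → ℝ :=
  Sum.elim (fun i r => -(M.G i r * r)) (fun j r => M.F j r * r)

/-! ### Uniformization: the discrete-time chain -/

namespace Policy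

variable {M} (P : M.Policy)

lemma rate_mem (q : State n m) (a : Arrival n m) : P.rate q a ∈ Icc 0 (M.rateMax a) := by
  cases a with
  | inl i => exact P.mu_mem q i
  | inr j => exact P.lam_mem q j

lemma rate_nonneg (q : State n m) (a : Arrival n m) : 0 ≤ P.rate q a := (P.rate_mem q a).1

lemma rateMax_nonneg (P : M.Policy) (a : Arrival n m) : 0 ≤ M.rateMax a :=
  (P.rate_nonneg 0 a).trans (P.rate_mem 0 a).2

lemma exitRate_nonneg (q : State n m) : 0 ≤ P.exitRate q :=
  Finset.sum_nonneg fun k _ => P.rate_nonneg q k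

lemma exitRate_lt (q : State n m) : P.exitRate q < M.uniformRate :=
  (Finset.sum_le_sum fun k _ => (P.rate_mem q k).2).trans_lt (lt_add_one _)

lemma uniformRate_pos (P : M.Policy) : 0 < M.uniformRate :=
  (P.exitRate_nonneg 0).trans_lt (P.exitRate_lt 0)

lemma departures_le (q : State n m) (k a : Arrival n m) :
    departures (P.matching q k) a ≤ afterArrival q k a := by
  cases a with
  | inl i => exact (P.matching_mem q k).2.1 i
  | inr j => exact (P.matching_mem q k).1 j

lemma next_add_departures (q : State n m) (k a : Arrival n m) :
    P.next q k a + departures (P.matching q k) a = q a + if a = k then 1 else 0 := by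
  have h := P.departures_le q k a
  have h2 : afterArrival q k a = q a + if a = k then 1 else 0 := by
    simp [afterArrival, Pi.single_apply]
  simp only [next, Pi.sub_apply]
  omega

lemma size_next_le (q : State n m) (k : Arrival n m) : size (P.next q k) ≤ size q + 1 := by
  calc size (P.next q k) ≤ ∑ a, (q a + if a = k then 1 else 0) :=
        Finset.sum_le_sum fun a _ => by
          have := P.next_add_departures q k a
          omega
    _ = size q + 1 := by simp [Finset.sum_add_distrib, size]

/-- The generator as a linear map. -/
def generatorMap : Module.End ℝ (State n m → ℝ) where
  toFun := P.generator
  map_add' f g := by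
    ext q
    simp only [generator, Pi.add_apply, ← Finset.sum_add_distrib]
    exact Finset.sum_congr rfl fun k _ => by ring
  map_smul' c f := by
    ext q
    simp only [generator, Pi.smul_apply, smul_eq_mul, RingHom.id_apply, Finset.mul_sum]
    exact Finset.sum_congr rfl fun k _ => by ring

/-- The transition operator of the uniformized chain. -/
noncomputable def step : Module.End ℝ (State n m → ℝ) := 1 + M.uniformRate⁻¹ • P.generatorMap

lemma generatorMap_eq : P.generatorMap = M.uniformRate • (P.step + (-1 : ℝ) • 1) := by
  have := P.uniformRate_pos.ne'
  simp [step, smul_smul, this]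

lemma uniformRate_mul_step (f : State n m → ℝ) (q : State n m) :
    M.uniformRate * P.step f q =
      (M.uniformRate - P.exitRate q) * f q + ∑ k, P.rate q k * f (P.next q k) := by
  have := P.uniformRate_pos.ne'
  have h : P.step f q = f q + M.uniformRate⁻¹ * P.generator f q := rfl
  rw [h, mul_add, mul_inv_cancel_left₀ this]
  simp only [generator, mul_sub, Finset.sum_sub_distrib, ← Finset.sum_mul, exitRate]
  ring

/-- Since `uniformRate` exceeds every exit rate, `step` averages over the current state and the
states reached at positive rate. -/
lemma step_mono {f g : State n m → ℝ} {q : State n m} (h₀ : f q ≤ g q)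
    (h : ∀ k, 0 < P.rate q k → f (P.next q k) ≤ g (P.next q k)) : P.step f q ≤ P.step g q := by
  refine le_of_mul_le_mul_left ?_ P.uniformRate_pos
  rw [uniformRate_mul_step, uniformRate_mul_step]
  refine add_le_add (mul_le_mul_of_nonneg_left h₀ (sub_nonneg.2 (P.exitRate_lt q).le))
    (Finset.sum_le_sum fun k _ => ?_)
  rcases (P.rate_nonneg q k).eq_or_lt with hk | hk
  · simp [← hk]
  · exact mul_le_mul_of_nonneg_left (h k hk) hk.le

lemma step_one : P.step 1 = 1 := by
  ext q
  have h := P.uniformRate_mul_step 1 q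
  simp only [Pi.one_apply, mul_one] at h
  have h2 : ∑ k, P.rate q k = P.exitRate q := rfl
  rw [h2, sub_add_cancel] at h
  exact mul_left_cancel₀ P.uniformRate_pos.ne' (h.trans (mul_one _).symm)

lemma step_pow_succ (l : ℕ) (f : State n m → ℝ) : (P.step ^ (l + 1)) f = P.step ((P.step ^ l) f) := by
  rw [pow_succ', Module.End.mul_apply]

lemma step_pow_one (l : ℕ) : (P.step ^ l) 1 = 1 := by
  induction l with
  | zero => rfl
  | succ l ih => rw [step_pow_succ, ih, step_one]

lemma accessible_next {q : State n m} {k : Arrival n m} (hk : 0 < P.rate q k) :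
    P.Accessible q (P.next q k) := Relation.ReflTransGen.single ⟨k, hk, rfl⟩

/-- Each step adds at most one to the total queue. The size restriction yields finite supports; the
accessibility restriction later confines arguments to the recurrent class. -/
lemma step_pow_mono {f g : State n m → ℝ} (l : ℕ) (q : State n m)
    (h : ∀ y, P.Accessible q y → size y ≤ size q + l → f y ≤ g y) :
    (P.step ^ l) f q ≤ (P.step ^ l) g q := by
  induction l generalizing q with
  | zero => exact h q Relation.ReflTransGen.refl le_rfl
  | succ l ih =>
    rw [step_pow_succ, step_pow_succ]
    refine P.step_mono (ih q fun y hy hs => h y hy (by omega)) fun k hk =>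
      ih _ fun y hy hs => h y ((P.accessible_next hk).trans hy) ?_
    have := P.size_next_le q k
    omega

lemma step_pow_congr {f g : State n m → ℝ} (l : ℕ) (q : State n m)
    (h : ∀ y, P.Accessible q y → size y ≤ size q + l → f y = g y) :
    (P.step ^ l) f q = (P.step ^ l) g q :=
  le_antisymm (P.step_pow_mono l q fun y h1 h2 => (h y h1 h2).le)
    (P.step_pow_mono l q fun y h1 h2 => (h y h1 h2).ge)

lemma step_pow_nonneg {f : State n m → ℝ} (hf : ∀ y, 0 ≤ f y) (l : ℕ) (q : State n m) :
    0 ≤ (P.step ^ l) f q := by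
  simpa using P.step_pow_mono (f := 0) l q fun y _ _ => hf y

lemma le_const_of_size_le {y : State n m} {N : ℕ} (h : size y ≤ N) : y ≤ fun _ => N := fun a =>
  (Finset.single_le_sum (f := y) (fun _ _ => Nat.zero_le _) (Finset.mem_univ a)).trans h

/-- The law of the uniformized chain after finitely many steps has finite support. -/
lemma step_pow_eq_sum (f : State n m → ℝ) {l N : ℕ} {q : State n m} (h : size q + l ≤ N) :
    (P.step ^ l) f q =
      ∑ y ∈ Finset.Iic (fun _ => N : State n m), (P.step ^ l) (Pi.single y 1) q * f y := by
  have h1 : (P.step ^ l) f q =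
      (P.step ^ l) (∑ y ∈ Finset.Iic (fun _ => N : State n m), f y • Pi.single y 1) q := by
    refine P.step_pow_congr l q fun y _ hy => ?_
    have : y ∈ Finset.Iic (fun _ => N : State n m) :=
      Finset.mem_Iic.2 (le_const_of_size_le (hy.trans h))
    simp [Finset.sum_apply, Pi.single_apply, le_const_of_size_le (hy.trans h)]
  rw [h1, map_sum, Finset.sum_apply]
  exact Finset.sum_congr rfl fun y _ => by simp [mul_comm]

/-! ### Time averages, Jensen's inequality and flow balance -/

/-- The average of the expectations of a function over the first `L` steps of the uniformized
chain. -/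
noncomputable def avg (z : State n m) (L : ℕ) : (State n m → ℝ) →ₗ[ℝ] ℝ :=
  (L : ℝ)⁻¹ • ∑ l ∈ Finset.range L, LinearMap.proj z ∘ₗ (P.step ^ l)

lemma avg_apply (z : State n m) (L : ℕ) (f : State n m → ℝ) :
    P.avg z L f = (L : ℝ)⁻¹ * ∑ l ∈ Finset.range L, (P.step ^ l) f z := by
  simp [avg]

lemma avg_mono {f g : State n m → ℝ} {z : State n m} (L : ℕ)
    (h : ∀ y, P.Accessible z y → f y ≤ g y) : P.avg z L f ≤ P.avg z L g := by
  rw [avg_apply, avg_apply]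
  exact mul_le_mul_of_nonneg_left
    (Finset.sum_le_sum fun l _ => P.step_pow_mono l z fun y hy _ => h y hy) (by positivity)

lemma avg_eq_zero {f : State n m → ℝ} {z : State n m} (L : ℕ)
    (h : ∀ y, P.Accessible z y → f y = 0) : P.avg z L f = 0 := by
  rw [← map_zero (P.avg z L)]
  exact le_antisymm (P.avg_mono L fun y hy => (h y hy).le) (P.avg_mono L fun y hy => (h y hy).ge)

lemma avg_nonneg {f : State n m → ℝ} {z : State n m} (L : ℕ)
    (h : ∀ y, 0 ≤ f y) : 0 ≤ P.avg z L f := by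
  rw [← map_zero (P.avg z L)]
  exact P.avg_mono L fun y _ => h y

lemma avg_one (z : State n m) {L : ℕ} (hL : 0 < L) : P.avg z L 1 = 1 := by
  have : (L : ℝ) ≠ 0 := by positivity
  simp [avg_apply, step_pow_one, this]

lemma avg_mem_Icc {f : State n m → ℝ} {z : State n m} {L : ℕ} (hL : 0 < L) {b : ℝ}
    (h : ∀ y, f y ∈ Icc 0 b) : P.avg z L f ∈ Icc 0 b := by
  refine ⟨P.avg_nonneg L fun y => (h y).1, ?_⟩
  have h1 : P.avg z L f ≤ P.avg z L (b • 1) := P.avg_mono L fun y _ => by simpa using (h y).2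
  rwa [map_smul, avg_one P z hL, smul_eq_mul, mul_one] at h1

/-- Jensen's inequality. -/
lemma avg_comp_le {φ : ℝ → ℝ} {b : ℝ} (hφ : ConcaveOn ℝ (Icc 0 b) φ) {f : State n m → ℝ}
    (h : ∀ y, f y ∈ Icc 0 b) (z : State n m) {L : ℕ} (hL : 0 < L) :
    P.avg z L (fun y => φ (f y)) ≤ φ (P.avg z L f) := by
  -- In fewer than `L` steps the chain stays in a finite box, so the average is a finite convex
  -- combination.
  have key : ∀ g : State n m → ℝ, P.avg z L g =
      ∑ y ∈ Finset.Iic (fun _ => size z + L : State n m), P.avg z L (Pi.single y 1) * g y := by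
    intro g
    simp only [avg_apply, Finset.mul_sum, Finset.sum_mul]
    rw [Finset.sum_comm]
    refine Finset.sum_congr rfl fun l hl => ?_
    have : l < L := Finset.mem_range.1 hl
    rw [P.step_pow_eq_sum g (show size z + l ≤ size z + L by omega), Finset.mul_sum]
    exact Finset.sum_congr rfl fun y _ => by ring
  have h1 := P.avg_one z hL
  rw [key] at h1
  rw [key, key f]
  refine hφ.le_map_sum (fun y _ => P.avg_nonneg L fun x => ?_) (by simpa using h1)
    (fun y _ => h y)
  by_cases hx : x = y <;> simp [hx]

/-- The generator is `uniformRate` times `step - 1`, so the sum over time telescopes. -/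
lemma avg_generator (z : State n m) (L : ℕ) (f : State n m → ℝ) :
    P.avg z L (P.generator f) = M.uniformRate * (L : ℝ)⁻¹ * ((P.step ^ L) f z - f z) := by
  have h : P.generator f = M.uniformRate • (P.step f - f) := by
    have := congrArg (fun A : Module.End ℝ (State n m → ℝ) => A f) P.generatorMap_eq
    simpa [sub_eq_add_neg, generatorMap] using this
  have h2 : (P.step ^ L) f z - f z =
      ∑ l ∈ Finset.range L, ((P.step ^ (l + 1)) f z - (P.step ^ l) f z) := by
    rw [Finset.sum_range_sub (fun l => (P.step ^ l) f z)]
    simp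
  rw [h, map_smul, avg_apply, h2, smul_eq_mul, mul_assoc]
  congr 2
  refine Finset.sum_congr rfl fun l _ => ?_
  rw [map_sub, Pi.sub_apply, pow_succ, Module.End.mul_apply]

/-- The rate at which servers of type `i` are matched to customers of type `j`. -/
def matchRate (q : State n m) (i : Fin n) (j : Fin m) : ℝ :=
  ∑ k, P.rate q k * (P.matching q k i j : ℝ)

lemma generator_coord (a : Arrival n m) (q : State n m) :
    P.generator (fun y => (y a : ℝ)) q = P.rate q a - load (P.matchRate q) a := by
  have h1 : ∀ k, ((P.next q k a : ℕ) : ℝ) - q a =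
      (if a = k then 1 else 0) - (departures (P.matching q k) a : ℝ) := by
    intro k
    have := congrArg (Nat.cast (R := ℝ)) (P.next_add_departures q k a)
    push_cast at this
    linarith
  have h2 : load (P.matchRate q) a = ∑ k, P.rate q k * (departures (P.matching q k) a : ℝ) := by
    cases a with
    | inl i =>
      simp only [load, matchRate, departures, Sum.elim_inl, Nat.cast_sum, Finset.mul_sum]
      exact Finset.sum_comm
    | inr j =>
      simp only [load, matchRate, departures, Sum.elim_inr, Nat.cast_sum, Finset.mul_sum]
      exact Finset.sum_comm
  simp only [generator, h1, mul_sub, Finset.sum_sub_distrib, h2]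
  simp

/-- The drift of a queue is its arrival rate minus its rate of matches, and both sides are linear in
the averaged law. -/
lemma avg_balance (z : State n m) (L : ℕ) (a : Arrival n m) :
    P.avg z L (fun q => P.rate q a) - load (fun i j => P.avg z L fun q => P.matchRate q i j) a =
      P.avg z L (P.generator fun y => (y a : ℝ)) := by
  have h : P.generator (fun y => (y a : ℝ)) =
      (fun q => P.rate q a) - fun q => load (P.matchRate q) a :=
    funext fun q => P.generator_coord a q
  rw [h, map_sub]
  congr 1
  cases a with
  | inl i =>
    have : (fun q => load (P.matchRate q) (Sum.inl i)) = ∑ j, fun q => P.matchRate q i j := by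
      ext q; simp [load]
    rw [this, map_sum]; rfl
  | inr j =>
    have : (fun q => load (P.matchRate q) (Sum.inr j)) = ∑ i, fun q => P.matchRate q i j := by
      ext q; simp [load]
    rw [this, map_sum]; rfl

end Policy
end System
end TwoSided

/-! ### Excursions, occupation measures and tightness -/

namespace TwoSided
namespace System
namespace Policy

variable {n m : ℕ} {M : System n m} (P : M.Policy)

/-- The expected integral of `g` along the chain started in `q`, during its first `l` sojourns and
before it first jumps into `z`. -/
noncomputable def occupation (z : State n m) (g : State n m → ℝ≥0∞) : ℕ → State n m → ℝ≥0∞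
  | 0, _ => 0
  | l + 1, q => (ENNReal.ofReal (P.exitRate q))⁻¹ * g q +
      ∑ k, ENNReal.ofReal (P.rate q k) / ENNReal.ofReal (P.exitRate q) *
        (if P.next q k = z then 0 else occupation z g l (P.next q k))

lemma occupation_one (z : State n m) (l : ℕ) (q : State n m) :
    P.occupation z (fun _ => 1) l q = P.timeToEnter z l q := by
  induction l generalizing q with
  | zero => rfl
  | succ l ih => simp only [occupation, timeToEnter, ih, mul_one]

lemma occupation_add (z : State n m) (g h : State n m → ℝ≥0∞) (l : ℕ) (q : State n m) :
    P.occupation z (fun y => g y + h y) l q = P.occupation z g l q + P.occupation z h l q := by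
  induction l generalizing q with
  | zero => simp [occupation]
  | succ l ih =>
    have : ∀ k, (if P.next q k = z then 0 else
          P.occupation z (fun y => g y + h y) l (P.next q k)) =
        (if P.next q k = z then 0 else P.occupation z g l (P.next q k)) +
        (if P.next q k = z then 0 else P.occupation z h l (P.next q k)) := by
      intro k; split_ifs <;> simp [ih]
    simp only [occupation, this, mul_add, Finset.sum_add_distrib]
    ring

lemma occupation_const_mul (z : State n m) (c : ℝ≥0∞) (g : State n m → ℝ≥0∞) (l : ℕ)
    (q : State n m) :
    P.occupation z (fun y => c * g y) l q = c * P.occupation z g l q := by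
  induction l generalizing q with
  | zero => simp [occupation]
  | succ l ih =>
    have : ∀ k, (if P.next q k = z then 0 else
          P.occupation z (fun y => c * g y) l (P.next q k)) =
        c * (if P.next q k = z then 0 else P.occupation z g l (P.next q k)) := by
      intro k; split_ifs <;> simp [ih]
    simp only [occupation, this, mul_add, Finset.mul_sum]
    congr 1
    · ring
    · exact Finset.sum_congr rfl fun k _ => by ring

lemma occupation_le_succ (z : State n m) (g : State n m → ℝ≥0∞) (l : ℕ) (q : State n m) :
    P.occupation z g l q ≤ P.occupation z g (l + 1) q := by
  induction l generalizing q with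
  | zero => simp [occupation]
  | succ l ih =>
    rw [occupation, occupation]
    gcongr with k
    split_ifs
    · exact le_rfl
    · exact ih _

lemma occupation_mono (z : State n m) (g : State n m → ℝ≥0∞) (q : State n m) :
    Monotone fun l => P.occupation z g l q :=
  monotone_nat_of_le_succ fun l => P.occupation_le_succ z g l q

lemma occupation_congr {z : State n m} {g h : State n m → ℝ≥0∞} (l : ℕ) (q : State n m)
    (hgh : ∀ y, size y ≤ size q + l → g y = h y) :
    P.occupation z g l q = P.occupation z h l q := by
  induction l generalizing q with
  | zero => rfl
  | succ l ih =>
    have : ∀ k, P.occupation z g l (P.next q k) = P.occupation z h l (P.next q k) := fun k =>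
      ih _ fun y hy => hgh y (by have := P.size_next_le q k; omega)
    simp only [occupation, this, hgh q (by omega)]

lemma ofReal_exitRate (q : State n m) :
    ENNReal.ofReal (P.exitRate q) = ∑ k, ENNReal.ofReal (P.rate q k) :=
  ENNReal.ofReal_sum_of_nonneg fun k _ => P.rate_nonneg q k

/-- A form of `uniformRate_mul_step` without subtraction, usable in `ℝ≥0∞`. -/
lemma ofReal_step_add {f : State n m → ℝ} (hf : ∀ y, 0 ≤ f y) (q : State n m) :
    ENNReal.ofReal M.uniformRate * ENNReal.ofReal (P.step f q) +
        ENNReal.ofReal (P.exitRate q) * ENNReal.ofReal (f q) =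
      ENNReal.ofReal M.uniformRate * ENNReal.ofReal (f q) +
        ∑ k, ENNReal.ofReal (P.rate q k) * ENNReal.ofReal (f (P.next q k)) := by
  have hL := P.uniformRate_pos.le
  have hs : 0 ≤ P.step f q := by simpa using P.step_pow_nonneg hf 1 q
  have he := P.exitRate_nonneg q
  simp_rw [← ENNReal.ofReal_mul hL, ← ENNReal.ofReal_mul he,
    ← ENNReal.ofReal_mul (P.rate_nonneg q _)]
  rw [← ENNReal.ofReal_sum_of_nonneg fun k _ => mul_nonneg (P.rate_nonneg q k) (hf _),
    ← ENNReal.ofReal_add (mul_nonneg hL hs) (mul_nonneg he (hf q)),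
    ← ENNReal.ofReal_add (mul_nonneg hL (hf q))
      (Finset.sum_nonneg fun k _ => mul_nonneg (P.rate_nonneg q k) (hf _)),
    uniformRate_mul_step]
  congr 1
  ring

/-- The occupation measure of an excursion from `z` is subinvariant for the uniformized chain. -/
lemma occupation_step_add_le (z : State n m) {f : State n m → ℝ} (hf : ∀ y, 0 ≤ f y) (l : ℕ)
    (q : State n m) :
    P.occupation z (fun y => ENNReal.ofReal M.uniformRate * ENNReal.ofReal (P.step f y)) l q +
        ENNReal.ofReal (f q) ≤
      ENNReal.ofReal M.uniformRate * P.occupation z (fun y => ENNReal.ofReal (f y)) (l + 1) q +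
        ENNReal.ofReal (f z) := by
  have hL : ENNReal.ofReal M.uniformRate ≠ 0 := by simpa using P.uniformRate_pos
  induction l generalizing q with
  | zero =>
    have h0 : P.occupation z (fun y => ENNReal.ofReal (f y)) (0 + 1) q =
        (ENNReal.ofReal (P.exitRate q))⁻¹ * ENNReal.ofReal (f q) := by
      simp [occupation]
    rw [h0, ← mul_assoc]
    have : 1 ≤ ENNReal.ofReal M.uniformRate * (ENNReal.ofReal (P.exitRate q))⁻¹ := by
      rw [← div_eq_mul_inv, ENNReal.le_div_iff_mul_le (Or.inr hL) (Or.inl ENNReal.ofReal_ne_top),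
        one_mul]
      exact ENNReal.ofReal_le_ofReal (P.exitRate_lt q).le
    calc _ = 1 * ENNReal.ofReal (f q) := by simp [occupation]
      _ ≤ _ := le_add_right (mul_le_mul_left this _)
  | succ l ih =>
    rw [occupation, occupation]
    have hst := P.ofReal_step_add hf q
    set e := ENNReal.ofReal (P.exitRate q) with he
    set u := ENNReal.ofReal M.uniformRate
    have heT : e ≠ ⊤ := ENNReal.ofReal_ne_top
    -- In an absorbing state the sojourn is infinite: the right side is `⊤` unless `f q` vanishes.
    by_cases h0 : e = 0
    · have hr : ∀ k, ENNReal.ofReal (P.rate q k) = 0 := by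
        have := P.ofReal_exitRate q
        rw [← he, h0] at this
        simpa using (Finset.sum_eq_zero_iff.1 this.symm)
      simp only [h0, hr, zero_mul, add_zero, Finset.sum_const_zero] at hst
      simp only [hr, h0, hst, ENNReal.zero_div, zero_mul, Finset.sum_const_zero, add_zero]
      by_cases hq : ENNReal.ofReal (f q) = 0
      · simp [hq]
      · rw [ENNReal.inv_zero, ENNReal.top_mul hq, ENNReal.mul_top hL, top_add]
        exact le_top
    -- Written this way, `f q` joins the sojourn term, and `hst` trades the two for the values of
    -- `f` after the jump. A jump into `z` leaves just `f z`; any other jump is handled by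
    -- induction.
    · have h1 : ENNReal.ofReal (f q) = e⁻¹ * (e * ENNReal.ofReal (f q)) := by
        rw [← mul_assoc, ENNReal.inv_mul_cancel h0 heT, one_mul]
      have h2 : ∑ k, ENNReal.ofReal (P.rate q k) / e = 1 := by
        simp only [div_eq_mul_inv]
        rw [← Finset.sum_mul, ← ofReal_exitRate, ENNReal.mul_inv_cancel h0 heT]
      have hk : ∀ k, ENNReal.ofReal (f (P.next q k)) +
          (if P.next q k = z then 0 else P.occupation z
            (fun y => u * ENNReal.ofReal (P.step f y)) l (P.next q k)) ≤
          u * (if P.next q k = z then 0 else P.occupation z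
            (fun y => ENNReal.ofReal (f y)) (l + 1) (P.next q k)) + ENNReal.ofReal (f z) := by
        intro k
        split_ifs with h
        · simp [h]
        · rw [add_comm]; exact ih _
      calc _ = e⁻¹ * (u * ENNReal.ofReal (P.step f q) + e * ENNReal.ofReal (f q)) +
            ∑ k, ENNReal.ofReal (P.rate q k) / e * (if P.next q k = z then 0 else P.occupation z
              (fun y => u * ENNReal.ofReal (P.step f y)) l (P.next q k)) := by
            conv_lhs => rw [h1]
            ring
        _ = e⁻¹ * (u * ENNReal.ofReal (f q)) +
            ∑ k, ENNReal.ofReal (P.rate q k) / e * (ENNReal.ofReal (f (P.next q k)) +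
              (if P.next q k = z then 0 else P.occupation z
              (fun y => u * ENNReal.ofReal (P.step f y)) l (P.next q k))) := by
            rw [hst]
            simp only [mul_add, Finset.sum_add_distrib, Finset.mul_sum, div_eq_mul_inv]
            rw [← add_assoc]
            congr 2
            exact Finset.sum_congr rfl fun k _ => by ring
        _ ≤ e⁻¹ * (u * ENNReal.ofReal (f q)) +
            ∑ k, ENNReal.ofReal (P.rate q k) / e *
              (u * (if P.next q k = z then 0 else P.occupation z
                (fun y => ENNReal.ofReal (f y)) (l + 1) (P.next q k)) + ENNReal.ofReal (f z)) := by
            exact add_le_add le_rfl (Finset.sum_le_sum fun k _ => mul_le_mul_right (hk k) _)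
        _ = _ := by
            simp only [mul_add, Finset.sum_add_distrib, ← Finset.sum_mul, h2, one_mul,
              Finset.mul_sum]
            rw [← add_assoc]
            congr 2
            · ring
            · exact Finset.sum_congr rfl fun k _ => by ring

/-- For an excursion started in `z` itself the boundary terms `f q` and `f z` cancel. -/
lemma iSup_occupation_step_le (z : State n m) {f : State n m → ℝ} (hf : ∀ y, 0 ≤ f y) :
    ⨆ l, P.occupation z (fun y => ENNReal.ofReal (P.step f y)) l z ≤
      ⨆ l, P.occupation z (fun y => ENNReal.ofReal (f y)) l z := by
  refine iSup_le fun l => le_iSup_of_le (l + 1) ?_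
  have h := P.occupation_step_add_le z hf l z
  rw [ENNReal.add_le_add_iff_right ENNReal.ofReal_ne_top, occupation_const_mul] at h
  exact (ENNReal.mul_le_mul_iff_right (by simpa using P.uniformRate_pos)
    ENNReal.ofReal_ne_top).1 h

lemma iSup_occupation_step_pow_le (z : State n m) {f : State n m → ℝ} (hf : ∀ y, 0 ≤ f y)
    (i : ℕ) :
    ⨆ l, P.occupation z (fun y => ENNReal.ofReal ((P.step ^ i) f y)) l z ≤
      ⨆ l, P.occupation z (fun y => ENNReal.ofReal (f y)) l z := by
  induction i with
  | zero => exact le_rfl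
  | succ i ih =>
    simp only [step_pow_succ]
    exact (P.iSup_occupation_step_le z fun y => P.step_pow_nonneg hf i y).trans ih

/-- The first sojourn gives `z` occupation mass at least `1 / exitRate z`; subinvariance propagates
this domination of the point mass at `z` to all later times. -/
lemma ofReal_step_pow_le {z : State n m} (hz : P.exitRate z ≠ 0) {f : State n m → ℝ}
    (hf : ∀ y, 0 ≤ f y) (i : ℕ) :
    ENNReal.ofReal ((P.step ^ i) f z) ≤ ENNReal.ofReal (P.exitRate z) *
      ⨆ l, P.occupation z (fun y => ENNReal.ofReal (f y)) l z := by
  have he : ENNReal.ofReal (P.exitRate z) ≠ 0 := by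
    simpa using lt_of_le_of_ne (P.exitRate_nonneg z) hz.symm
  have h1 : (ENNReal.ofReal (P.exitRate z))⁻¹ * ENNReal.ofReal ((P.step ^ i) f z) ≤
      ⨆ l, P.occupation z (fun y => ENNReal.ofReal (f y)) l z := by
    refine le_trans ?_ (P.iSup_occupation_step_pow_le z hf i)
    refine le_iSup_of_le 1 ?_
    simp [occupation]
  calc _ = ENNReal.ofReal (P.exitRate z) *
        ((ENNReal.ofReal (P.exitRate z))⁻¹ * ENNReal.ofReal ((P.step ^ i) f z)) := by
        rw [← mul_assoc, ENNReal.mul_inv_cancel he ENNReal.ofReal_ne_top, one_mul]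
    _ ≤ _ := mul_le_mul_right h1 _

/-- The indicator function of the states with more than `R` waiting customers and servers. -/
noncomputable def tail (R : ℕ) (y : State n m) : ℝ := if R < size y then 1 else 0

lemma tail_nonneg (R : ℕ) (y : State n m) : 0 ≤ tail R y := by
  unfold tail; split_ifs <;> simp

/-- Finitely many sojourns account for the mean return time up to `ε`, and they only visit states of
bounded size. The time spent in larger states is therefore part of the remaining `ε`. -/
lemma exists_occupation_tail_le {z : State n m} (hz : P.meanReturnTime z < ∞) {ε : ℝ≥0∞}
    (hε : 0 < ε) :
    ∃ R, ⨆ l, P.occupation z (fun y => ENNReal.ofReal (tail R y)) l z ≤ ε := by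
  obtain ⟨l, hl⟩ : ∃ l, P.meanReturnTime z ≤ P.timeToEnter z l z + ε := by
    by_cases h0 : P.meanReturnTime z = 0
    · exact ⟨0, by simp [h0]⟩
    · have := ENNReal.sub_lt_self hz.ne h0 hε.ne'
      obtain ⟨l, hl⟩ := lt_iSup_iff.1 (this.trans_eq (rfl : _ = ⨆ l, P.timeToEnter z l z))
      exact ⟨l, tsub_le_iff_right.1 hl.le⟩
  refine ⟨size z + l, iSup_le fun k => ?_⟩
  set g : State n m → ℝ≥0∞ := fun y => ENNReal.ofReal (tail (size z + l) y)
  set h : State n m → ℝ≥0∞ := fun y => if size y ≤ size z + l then 1 else 0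
  have hgh : (fun y => g y + h y) = fun _ => 1 := by
    ext y
    by_cases hy : size y ≤ size z + l
    · simp [g, h, tail, hy, not_lt.2 hy]
    · simp [g, h, tail, hy, not_le.1 hy]
  have h1 : P.occupation z h l z = P.timeToEnter z l z := by
    rw [← occupation_one]
    exact P.occupation_congr l z fun y hy => by simp [h, hy]
  have hfin : P.timeToEnter z l z ≠ ∞ := ((le_iSup _ l).trans_lt hz).ne
  have h2 : P.occupation z g k z + P.timeToEnter z l z ≤ ε + P.timeToEnter z l z := by
    calc _ ≤ P.occupation z g (max k l) z + P.occupation z h (max k l) z := by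
          rw [← h1]
          exact add_le_add (P.occupation_mono z g z (le_max_left _ _))
            (P.occupation_mono z h z (le_max_right _ _))
      _ = P.timeToEnter z (max k l) z := by rw [← occupation_add, hgh, occupation_one]
      _ ≤ P.meanReturnTime z := le_iSup (fun l => P.timeToEnter z l z) _
      _ ≤ _ := hl.trans_eq (add_comm _ _)
  exact (ENNReal.add_le_add_iff_right hfin).1 h2

lemma rate_eq_zero_of_exitRate {q : State n m} (h : P.exitRate q = 0) (k : Arrival n m) :
    P.rate q k = 0 :=
  (Finset.sum_eq_zero_iff_of_nonneg fun k _ => P.rate_nonneg q k).1 h k (Finset.mem_univ k)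

lemma eq_of_accessible_of_exitRate {z w : State n m} (h : P.exitRate z = 0)
    (hw : P.Accessible z w) : w = z := by
  induction hw with
  | refl => rfl
  | tail _ hbc ih =>
    obtain ⟨k, hk, rfl⟩ := hbc
    rw [ih, P.rate_eq_zero_of_exitRate h] at hk
    exact absurd hk (lt_irrefl _)

/-- The laws of the uniformized chain started in a positive recurrent state are tight. -/
lemma exists_step_pow_tail_le {z : State n m} (hz : P.PositiveRecurrent z) {ε : ℝ} (hε : 0 < ε) :
    ∃ R, ∀ i, (P.step ^ i) (tail R) z ≤ ε := by
  by_cases h0 : P.exitRate z = 0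
  · refine ⟨size z, fun i => ?_⟩
    have h1 : (P.step ^ i) (tail (size z)) z = (P.step ^ i) 0 z :=
      P.step_pow_congr i z fun y hy _ => by
        simp [P.eq_of_accessible_of_exitRate h0 hy, tail]
    rw [h1, map_zero]
    exact hε.le
  · have hz' : P.meanReturnTime z < ∞ := hz.resolve_left h0
    have hpos : 0 < P.exitRate z := lt_of_le_of_ne (P.exitRate_nonneg z) (Ne.symm h0)
    obtain ⟨R, hR⟩ := P.exists_occupation_tail_le hz' (ε := ENNReal.ofReal (ε / P.exitRate z))
      (by simpa using div_pos hε hpos)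
    refine ⟨R, fun i => ?_⟩
    have h1 := (P.ofReal_step_pow_le h0 (tail_nonneg R) i).trans (mul_le_mul_right hR _)
    rw [← ENNReal.ofReal_mul hpos.le, mul_div_cancel₀ _ hpos.ne'] at h1
    exact (ENNReal.ofReal_le_ofReal_iff hε.le).1 h1

/-- The expected queue lengths of the uniformized chain grow sublinearly. -/
lemma exists_step_pow_size_le {z : State n m} (hz : P.PositiveRecurrent z) {ε : ℝ} (hε : 0 < ε) :
    ∃ C : ℝ, ∀ i : ℕ, (P.step ^ i) (fun y => (size y : ℝ)) z ≤ C + ε * i := by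
  obtain ⟨R, hR⟩ := P.exists_step_pow_tail_le hz hε
  refine ⟨R + ε * size z, fun i => ?_⟩
  -- The size is at most `R` off the tail and at most `size z + i` on it.
  have h1 : (P.step ^ i) (fun y => (size y : ℝ)) z ≤
      (P.step ^ i) ((R : ℝ) • 1 + ((size z + i : ℕ) : ℝ) • tail R) z := by
    refine P.step_pow_mono i z fun y _ hy => ?_
    simp only [Pi.add_apply, Pi.smul_apply, Pi.one_apply, smul_eq_mul, mul_one, tail]
    split_ifs with h
    · have : (size y : ℝ) ≤ (size z + i : ℕ) := Nat.cast_le.2 hy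
      have hR0 : (0 : ℝ) ≤ R := Nat.cast_nonneg R
      linarith
    · simpa using h
  rw [map_add, map_smul, map_smul, step_pow_one] at h1
  simp only [Pi.add_apply, Pi.smul_apply, Pi.one_apply, smul_eq_mul, mul_one] at h1
  have h2 := mul_le_mul_of_nonneg_left (hR i) (Nat.cast_nonneg (α := ℝ) (size z + i))
  push_cast at h1 h2
  linarith

/-! ### Positive recurrent classes are closed -/

lemma iSup_timeToEnter_next_lt_top {z q : State n m} {k : Arrival n m} (hk : 0 < P.rate q k)
    (hne : P.next q k ≠ z) (hq : ⨆ l, P.timeToEnter z l q < ∞) :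
    ⨆ l, P.timeToEnter z l (P.next q k) < ∞ := by
  set c := ENNReal.ofReal (P.rate q k) / ENNReal.ofReal (P.exitRate q) with hc
  have hc0 : c ≠ 0 := ENNReal.div_ne_zero.2 ⟨by simpa using hk, ENNReal.ofReal_ne_top⟩
  have h1 : c * ⨆ l, P.timeToEnter z l (P.next q k) ≤ ⨆ l, P.timeToEnter z l q := by
    rw [ENNReal.mul_iSup]
    refine iSup_le fun l => le_iSup_of_le (l + 1) ?_
    rw [timeToEnter]
    refine le_add_left ?_
    have h2 := Finset.single_le_sum (f := fun k =>
      ENNReal.ofReal (P.rate q k) / ENNReal.ofReal (P.exitRate q) *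
        (if P.next q k = z then 0 else P.timeToEnter z l (P.next q k)))
      (fun _ _ => zero_le) (Finset.mem_univ k)
    simpa [hne] using h2
  by_contra hcon
  rw [not_lt_top_iff] at hcon
  rw [hcon, ENNReal.mul_top hc0] at h1
  exact absurd (h1.trans_lt hq) (lt_irrefl _)

lemma iSup_timeToEnter_lt_top {z w : State n m} (hz : P.meanReturnTime z < ∞)
    (hw : P.Accessible z w) : ⨆ l, P.timeToEnter z l w < ∞ := by
  induction hw with
  | refl => exact hz
  | @tail b _ _ hbc ih =>
    obtain ⟨k, hk, rfl⟩ := hbc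
    by_cases hne : P.next b k = z
    · rw [hne]; exact hz
    · exact P.iSup_timeToEnter_next_lt_top hk hne ih

/-- No jump ever enters `z`, and each sojourn has mean at least `1 / uniformRate`. So the expected
time to enter an inaccessible state is infinite. -/
lemma le_timeToEnter {z : State n m} (l : ℕ) {q : State n m} (hq : ¬ P.Accessible q z) :
    (l : ℝ≥0∞) * (ENNReal.ofReal M.uniformRate)⁻¹ ≤ P.timeToEnter z l q := by
  induction l generalizing q with
  | zero => simp
  | succ l ih =>
    have hle : (ENNReal.ofReal M.uniformRate)⁻¹ ≤ (ENNReal.ofReal (P.exitRate q))⁻¹ :=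
      ENNReal.inv_le_inv.2 (ENNReal.ofReal_le_ofReal (P.exitRate_lt q).le)
    rw [timeToEnter]
    by_cases h0 : ENNReal.ofReal (P.exitRate q) = 0
    · simp [h0]
    have h2 : ∑ k, ENNReal.ofReal (P.rate q k) / ENNReal.ofReal (P.exitRate q) = 1 := by
      simp only [div_eq_mul_inv]
      rw [← Finset.sum_mul, ← ofReal_exitRate, ENNReal.mul_inv_cancel h0 ENNReal.ofReal_ne_top]
    calc _ = (ENNReal.ofReal M.uniformRate)⁻¹ +
          (∑ k, ENNReal.ofReal (P.rate q k) / ENNReal.ofReal (P.exitRate q)) *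
            ((l : ℝ≥0∞) * (ENNReal.ofReal M.uniformRate)⁻¹) := by
          rw [h2]; push_cast; ring
      _ ≤ _ := by
          rw [Finset.sum_mul]
          refine add_le_add hle (Finset.sum_le_sum fun k _ => ?_)
          rcases (P.rate_nonneg q k).eq_or_lt with hk | hk
          · simp [← hk]
          · have hna : ¬ P.Accessible (P.next q k) z := fun h =>
              hq ((P.accessible_next hk).trans h)
            have hne : P.next q k ≠ z := fun h => hna (h ▸ Relation.ReflTransGen.refl)
            rw [if_neg hne]
            exact mul_le_mul_right (ih hna) _

/-- The states accessible from a positive recurrent state communicate with it. -/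
lemma accessible_symm {z w : State n m} (hz : P.PositiveRecurrent z) (hw : P.Accessible z w) :
    P.Accessible w z := by
  by_cases h0 : P.exitRate z = 0
  · rw [P.eq_of_accessible_of_exitRate h0 hw]
    exact Relation.ReflTransGen.refl
  · by_contra hcon
    have hfin := P.iSup_timeToEnter_lt_top (hz.resolve_left h0) hw
    set u := (ENNReal.ofReal M.uniformRate)⁻¹ with hu
    have hu0 : u ≠ 0 := ENNReal.inv_ne_zero.2 ENNReal.ofReal_ne_top
    have huT : u ≠ ∞ := ENNReal.inv_ne_top.2 (by simpa using P.uniformRate_pos)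
    have h1 : ∀ l : ℕ, (l : ℝ≥0∞) * u ≤ ⨆ l, P.timeToEnter z l w := fun l =>
      (P.le_timeToEnter l hcon).trans (le_iSup (fun l => P.timeToEnter z l w) l)
    obtain ⟨N, hN⟩ := ENNReal.exists_nat_gt (ENNReal.div_ne_top hfin.ne hu0)
    have h2 := (ENNReal.le_div_iff_mul_le (Or.inl hu0) (Or.inl huT)).2 (h1 N)
    exact absurd (hN.trans_le h2) (lt_irrefl _)

end Policy
end System
end TwoSided

/-! ### Concavity and perturbation of the fluid problem -/

namespace TwoSided

/-- A concave function lies above the smaller of its end values; reflection in the midpoint turns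
this into an upper bound. Continuity at the ends is not needed. -/
lemma exists_abs_le_of_concaveOn {φ : ℝ → ℝ} {b : ℝ} (hb : 0 ≤ b)
    (h : ConcaveOn ℝ (Icc 0 b) φ) : ∃ B, ∀ r ∈ Icc 0 b, |φ r| ≤ B := by
  have hlow : ∀ r ∈ Icc 0 b, min (φ 0) (φ b) ≤ φ r := fun r hr =>
    h.min_le_of_mem_Icc (left_mem_Icc.2 hb) (right_mem_Icc.2 hb) hr
  refine ⟨max (-min (φ 0) (φ b)) (2 * φ (b / 2) - min (φ 0) (φ b)), fun r hr => abs_le'.2 ⟨?_, ?_⟩⟩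
  · have hr' : b - r ∈ Icc 0 b := ⟨by linarith [hr.2], by linarith [hr.1]⟩
    have h1 := h.2 hr hr' (show (0 : ℝ) ≤ 1 / 2 by norm_num) (show (0 : ℝ) ≤ 1 / 2 by norm_num)
      (by norm_num)
    simp only [smul_eq_mul] at h1
    rw [show 1 / 2 * r + 1 / 2 * (b - r) = b / 2 by ring] at h1
    exact le_max_of_le_right (by linarith [hlow _ hr'])
  · exact le_max_of_le_left (by linarith [hlow r hr])

lemma load_add {n m : ℕ} (χ ψ : Fin n → Fin m → ℝ) (c d : ℝ) (a : Arrival n m) :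
    load (fun i j => c * χ i j + d * ψ i j) a = c * load χ a + d * load ψ a := by
  cases a <;> simp [load, Finset.sum_add_distrib, Finset.mul_sum]

lemma load_nonneg {n m : ℕ} {χ : Fin n → Fin m → ℝ} (h : ∀ i j, 0 ≤ χ i j) (a : Arrival n m) :
    0 ≤ load χ a := by
  cases a with
  | inl i => simpa [load] using Finset.sum_nonneg fun j _ => h i j
  | inr j => simpa [load] using Finset.sum_nonneg fun i _ => h i j

namespace System

variable {n m : ℕ} (M : System n m)

lemma fluidObjective_eq (v : (Fin m → ℝ) × (Fin n → ℝ) × (Fin n → Fin m → ℝ)) :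
    M.fluidObjective v = ∑ a, M.revenue a (Sum.elim v.2.1 v.1 a) := by
  simp [fluidObjective, revenue, Fintype.sum_sum_type]
  ring

variable {M}

lemma concaveOn_revenue
    (hF : ∀ j, ConcaveOn ℝ (Set.Icc 0 (M.lamMax j)) (fun r => r * M.F j r))
    (hG : ∀ i, ConvexOn ℝ (Set.Icc 0 (M.muMax i)) (fun r => r * M.G i r)) (a : Arrival n m) :
    ConcaveOn ℝ (Icc 0 (M.rateMax a)) (M.revenue a) := by
  cases a with
  | inl i => exact (hG i).neg.congr fun r _ => by simp [revenue, mul_comm]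
  | inr j => exact (hF j).congr fun r _ => by simp [revenue, mul_comm]

lemma exists_abs_revenue_le (hmax : ∀ a, 0 ≤ M.rateMax a)
    (hC : ∀ a, ConcaveOn ℝ (Icc 0 (M.rateMax a)) (M.revenue a)) :
    ∃ B, 0 ≤ B ∧ ∀ r : Arrival n m → ℝ, (∀ a, r a ∈ Icc 0 (M.rateMax a)) →
      |∑ a, M.revenue a (r a)| ≤ B := by
  choose B hB using fun a => exists_abs_le_of_concaveOn (hmax a) (hC a)
  refine ⟨∑ a, B a, Finset.sum_nonneg fun a _ =>
    (abs_nonneg _).trans (hB a 0 (left_mem_Icc.2 (hmax a))), fun r hr => ?_⟩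
  exact (Finset.abs_sum_le_sum_abs _ _).trans (Finset.sum_le_sum fun a _ => hB a _ (hr a))

lemma isLUB_fluidValue (hmax : ∀ a, 0 ≤ M.rateMax a)
    (hC : ∀ a, ConcaveOn ℝ (Icc 0 (M.rateMax a)) (M.revenue a)) :
    IsLUB (M.fluidObjective '' M.fluidFeasible) M.fluidValue := by
  refine isLUB_csSup ⟨_, mem_image_of_mem _ (?_ : (0, 0, 0) ∈ M.fluidFeasible)⟩ ?_
  · exact ⟨fun j => ⟨le_rfl, hmax (Sum.inr j)⟩, fun i => ⟨le_rfl, hmax (Sum.inl i)⟩,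
      by simp, by simp, by simp, by simp⟩
  · obtain ⟨B, -, hB⟩ := exists_abs_revenue_le hmax hC
    refine ⟨B, ?_⟩
    rintro _ ⟨v, hv, rfl⟩
    rw [fluidObjective_eq]
    refine (le_abs_self _).trans (hB _ fun a => ?_)
    cases a with
    | inl i => exact hv.2.1 i
    | inr j => exact hv.1 j

lemma sum_revenue_load_le (hmax : ∀ a, 0 ≤ M.rateMax a)
    (hC : ∀ a, ConcaveOn ℝ (Icc 0 (M.rateMax a)) (M.revenue a)) {χ : Fin n → Fin m → ℝ}
    (hχ : ∀ i j, 0 ≤ χ i j) (hedge : ∀ i j, ¬ M.edge i j → χ i j = 0)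
    (hload : ∀ a, load χ a ≤ M.rateMax a) :
    ∑ a, M.revenue a (load χ a) ≤ M.fluidValue := by
  have h := (isLUB_fluidValue hmax hC).1 (mem_image_of_mem M.fluidObjective
    (show (fun j => load χ (Sum.inr j), fun i => load χ (Sum.inl i), χ) ∈ M.fluidFeasible from
      ⟨fun j => ⟨load_nonneg hχ (Sum.inr j), hload (Sum.inr j)⟩,
        fun i => ⟨load_nonneg hχ (Sum.inl i), hload (Sum.inl i)⟩,
        fun j => rfl, fun i => rfl, hedge, fun i j _ => hχ i j⟩))
  rw [fluidObjective_eq] at h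
  refine le_of_eq_of_le (Finset.sum_congr rfl fun a _ => ?_) h
  cases a <;> rfl

/-- A compatible pair of types both of which can arrive. -/
def Live (M : System n m) (i : Fin n) (j : Fin m) : Prop :=
  M.edge i j ∧ 0 < M.muMax i ∧ 0 < M.lamMax j

open Classical in
/-- The number of live pairs that contain a given type. -/
noncomputable def liveDegree (M : System n m) : Arrival n m → ℝ :=
  load fun i j => if M.Live i j then 1 else 0

lemma liveDegree_eq_zero_or (a : Arrival n m) : M.liveDegree a = 0 ∨ 1 ≤ M.liveDegree a := by
  classical
  have key : ∃ N : ℕ, M.liveDegree a = N := by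
    cases a with
    | inl i => exact ⟨∑ j, if M.Live i j then 1 else 0, by simp [liveDegree, load]⟩
    | inr j => exact ⟨∑ i, if M.Live i j then 1 else 0, by simp [liveDegree, load]⟩
  obtain ⟨N, hN⟩ := key
  rw [hN]
  rcases Nat.eq_zero_or_pos N with h | h
  · left; simp [h]
  · right; exact_mod_cast h

lemma liveDegree_eq_zero_of_rateMax {a : Arrival n m} (h : M.rateMax a = 0) :
    M.liveDegree a = 0 := by
  cases a with
  | inl i =>
    have h' : M.muMax i = 0 := h
    simp [liveDegree, load, Live, h']
  | inr j =>
    have h' : M.lamMax j = 0 := h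
    simp [liveDegree, load, Live, h']

lemma departures_eq_zero {a : Arrival n m} (ha : M.liveDegree a = 0) {x : Matching n m}
    (hx : ∀ i j, ¬ M.Live i j → x i j = 0) : departures x a = 0 := by
  classical
  cases a with
  | inl i =>
    simp only [departures, Sum.elim_inl]
    simp only [liveDegree, load, Sum.elim_inl, Finset.sum_boole, Nat.cast_eq_zero,
      Finset.card_eq_zero, Finset.filter_eq_empty_iff] at ha
    exact Finset.sum_eq_zero fun j hj => hx i j (ha hj)
  | inr j =>
    simp only [departures, Sum.elim_inr]
    simp only [liveDegree, load, Sum.elim_inr, Finset.sum_boole, Nat.cast_eq_zero,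
      Finset.card_eq_zero, Finset.filter_eq_empty_iff] at ha
    exact Finset.sum_eq_zero fun i hi => hx i j (ha hi)

/-- A flow of `κ` on every live pair uses at most half of each capacity, leaving the other half for
corrections. Types of zero capacity are in no live pair. -/
lemma exists_mul_liveDegree_le (hmax : ∀ a, 0 ≤ M.rateMax a) :
    ∃ κ > 0, ∀ a, κ * M.liveDegree a ≤ M.rateMax a / 2 := by
  have h : ∀ᶠ κ in 𝓝[>] (0 : ℝ), ∀ a, κ * M.liveDegree a ≤ M.rateMax a / 2 := by
    refine eventually_all.2 fun a => ?_
    rcases (hmax a).eq_or_lt with h | h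
    · simp [liveDegree_eq_zero_of_rateMax h.symm, ← h]
    · have : Tendsto (fun κ : ℝ => κ * M.liveDegree a) (𝓝[>] 0) (𝓝 (0 * M.liveDegree a)) :=
        ((continuous_id.mul continuous_const).tendsto 0).mono_left nhdsWithin_le_nhds
      rw [zero_mul] at this
      exact (this.eventually_lt_const (half_pos h)).mono fun κ hκ => hκ.le
  obtain ⟨κ, h1, h2⟩ := (h.and self_mem_nhdsWithin).exists
  exact ⟨κ, h2, h1⟩

/-- Rates that nearly satisfy the balance equations earn at most slightly more than the optimal
value of the fluid problem. -/
lemma exists_sum_revenue_le_of_nearly_balanced (hmax : ∀ a, 0 ≤ M.rateMax a)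
    (hC : ∀ a, ConcaveOn ℝ (Icc 0 (M.rateMax a)) (M.revenue a)) :
    ∃ κ > 0, ∃ B : ℝ, ∀ δ ∈ Ioo (0 : ℝ) 1, ∀ (r : Arrival n m → ℝ) (χ : Fin n → Fin m → ℝ),
      (∀ a, r a ∈ Icc 0 (M.rateMax a)) → (∀ i j, 0 ≤ χ i j) →
      (∀ i j, ¬ M.edge i j → χ i j = 0) → (∀ a, |r a - load χ a| ≤ δ * κ) →
      (∀ a, M.liveDegree a = 0 → r a - load χ a = 0) →
      (1 - δ) * ∑ a, M.revenue a (r a) ≤ M.fluidValue + δ * B := by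
  classical
  obtain ⟨κ, hκ, hκl⟩ := exists_mul_liveDegree_le hmax
  obtain ⟨B, -, hB⟩ := exists_abs_revenue_le hmax hC
  refine ⟨κ, hκ, B, fun δ hδ r χ hr hχ hedge hd hd0 => ?_⟩
  obtain ⟨hδ0, hδ1⟩ := hδ
  set ψ : Fin n → Fin m → ℝ := fun i j => if M.Live i j then 1 else 0 with hψ
  set χ' : Fin n → Fin m → ℝ := fun i j => (1 - δ) * χ i j + (δ * κ) * ψ i j with hχ'
  -- Chosen so that the loads of `χ'` are `(1 - δ) r + δ y`. On a type with a live pair the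
  -- correction is at most `κ`, hence at most `κ * liveDegree`, and so `y` stays between zero and
  -- the capacity.
  set y : Arrival n m → ℝ := fun a =>
    κ * M.liveDegree a - (1 - δ) * (r a - load χ a) / δ with hy
  have hload : ∀ a, load χ' a = (1 - δ) * r a + δ * y a := by
    intro a
    have : load ψ a = M.liveDegree a := rfl
    simp only [hχ', load_add, hy, this]
    field_simp
    ring
  have hymem : ∀ a, y a ∈ Icc 0 (M.rateMax a) := by
    intro a
    rcases M.liveDegree_eq_zero_or a with h | h
    · simp only [hy, h, hd0 a h]
      simpa using hmax a
    · have h1 : |(1 - δ) * (r a - load χ a) / δ| ≤ κ := by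
        rw [abs_div, abs_mul, abs_of_pos hδ0, abs_of_pos (sub_pos.2 hδ1), div_le_iff₀ hδ0]
        have := mul_le_mul_of_nonneg_left (hd a) (sub_pos.2 hδ1).le
        nlinarith [mul_pos hδ0 hκ]
      have h2 := abs_le.1 h1
      have h3 : κ ≤ κ * M.liveDegree a := le_mul_of_one_le_right hκ.le h
      have h4 := hκl a
      exact ⟨by simp only [hy]; linarith, by simp only [hy]; linarith⟩
  have h1δ : 0 ≤ 1 - δ := by linarith
  have hfl : ∑ a, M.revenue a (load χ' a) ≤ M.fluidValue := by
    refine sum_revenue_load_le hmax hC (fun i j => ?_) (fun i j hij => ?_) fun a => ?_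
    · have : 0 ≤ ψ i j := by simp only [hψ]; split_ifs <;> simp
      have := hχ i j
      positivity
    · have : ¬ M.Live i j := fun h => hij h.1
      simp [hχ', hψ, hedge i j hij, this]
    · rw [hload]
      nlinarith [(hr a).2, (hymem a).2, mul_le_mul_of_nonneg_left (hr a).2 h1δ,
        mul_le_mul_of_nonneg_left (hymem a).2 hδ0.le]
  have hconc : (1 - δ) * ∑ a, M.revenue a (r a) + δ * ∑ a, M.revenue a (y a) ≤
      ∑ a, M.revenue a (load χ' a) := by
    rw [Finset.mul_sum, Finset.mul_sum, ← Finset.sum_add_distrib]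
    refine Finset.sum_le_sum fun a _ => ?_
    rw [hload]
    exact (hC a).2 (hr a) (hymem a) h1δ hδ0.le (by ring)
  have := mul_le_mul_of_nonneg_left (neg_le_of_abs_le (hB y hymem)) hδ0.le
  linarith

/-! ### The recurrent class and the bound for the uniformized chain -/

namespace Policy

variable (P : M.Policy)

lemma eq_zero_of_rateMax {q : State n m} (hq : P.Accessible 0 q) {a : Arrival n m}
    (ha : M.rateMax a = 0) : q a = 0 := by
  induction hq with
  | refl => rfl
  | @tail b _ _ hbc ih =>
    obtain ⟨k, hk, rfl⟩ := hbc
    have hak : a ≠ k := by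
      rintro rfl
      exact absurd (hk.trans_le (P.rate_mem b a).2) (by simp [ha])
    have := P.next_add_departures b k a
    simp only [hak, if_false, ih] at this
    omega

/-- A pair that is not live either is incompatible or contains a type that cannot arrive, whose
queue stays empty from the empty state onwards. -/
lemma matching_eq_zero {q : State n m} (hq : P.Accessible 0 q) {k : Arrival n m}
    (hk : 0 < P.rate q k) {i : Fin n} {j : Fin m} (hij : ¬ M.Live i j) :
    P.matching q k i j = 0 := by
  have key : ∀ a, M.rateMax a = 0 → departures (P.matching q k) a = 0 := by
    intro a ha
    have hak : a ≠ k := by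
      rintro rfl
      exact absurd (hk.trans_le (P.rate_mem q a).2) (by simp [ha])
    have h1 := P.departures_le q k a
    simpa [afterArrival, hak, P.eq_zero_of_rateMax hq ha] using h1
  by_cases he : M.edge i j
  · by_cases hi : 0 < M.muMax i
    · have hj : M.lamMax j = 0 := le_antisymm (not_lt.1 fun h => hij ⟨he, hi, h⟩)
        (P.rateMax_nonneg (Sum.inr j))
      have h := key (Sum.inr j) hj
      simp only [departures, Sum.elim_inr, Finset.sum_eq_zero_iff] at h
      exact h i (Finset.mem_univ i)
    · have hi' : M.muMax i = 0 := le_antisymm (not_lt.1 hi) (P.rateMax_nonneg (Sum.inl i))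
      have h := key (Sum.inl i) hi'
      simp only [departures, Sum.elim_inl, Finset.sum_eq_zero_iff] at h
      exact h j (Finset.mem_univ j)
  · exact (P.matching_mem q k).2.2 i j he

lemma le_of_liveDegree {q w : State n m} (hq : P.Accessible 0 q) (hw : P.Accessible q w)
    {a : Arrival n m} (ha : M.liveDegree a = 0) : q a ≤ w a := by
  induction hw with
  | refl => exact le_rfl
  | @tail b _ hb hbc ih =>
    obtain ⟨k, hk, rfl⟩ := hbc
    have h1 := P.next_add_departures b k a
    rw [departures_eq_zero ha fun i j => P.matching_eq_zero (hq.trans hb) hk] at h1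
    omega

/-- In the recurrent class, a type that cannot be matched does not arrive. -/
lemma rate_eq_zero_of_liveDegree {z q : State n m} (hz0 : P.Accessible 0 z)
    (hz : P.PositiveRecurrent z) (hq : P.Accessible z q) {a : Arrival n m}
    (ha : M.liveDegree a = 0) : P.rate q a = 0 := by
  by_contra hne
  have hpos : 0 < P.rate q a := lt_of_le_of_ne (P.rate_nonneg q a) (Ne.symm hne)
  have hn := P.accessible_next hpos
  -- The arrival lengthens a queue from which nobody ever departs, so a return to `q` is
  -- contradictory.
  have hback : P.Accessible (P.next q a) q := (P.accessible_symm hz (hq.trans hn)).trans hq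
  have h0q := hz0.trans hq
  have h1 := P.le_of_liveDegree (h0q.trans hn) hback ha
  have h2 := P.next_add_departures q a a
  rw [departures_eq_zero ha fun i j => P.matching_eq_zero h0q hpos] at h2
  simp only [if_true] at h2
  omega

lemma matchRate_nonneg (q : State n m) (i : Fin n) (j : Fin m) : 0 ≤ P.matchRate q i j :=
  Finset.sum_nonneg fun k _ => mul_nonneg (P.rate_nonneg q k) (Nat.cast_nonneg _)

lemma generator_coord_eq_zero {z q : State n m} (hz0 : P.Accessible 0 z)
    (hz : P.PositiveRecurrent z) (hq : P.Accessible z q) {a : Arrival n m}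
    (ha : M.liveDegree a = 0) : P.generator (fun y => (y a : ℝ)) q = 0 := by
  refine Finset.sum_eq_zero fun k _ => ?_
  rcases (P.rate_nonneg q k).eq_or_lt with hk | hk
  · simp [← hk]
  · have h1 := P.next_add_departures q k a
    have hak : a ≠ k := by
      rintro rfl
      exact hk.ne' (P.rate_eq_zero_of_liveDegree hz0 hz hq ha)
    rw [departures_eq_zero ha fun i j => P.matching_eq_zero (hz0.trans hq) hk] at h1
    simp only [hak, if_false, add_zero] at h1
    simp [h1]

/-- The telescoped drift is an increment of the mean queue length divided by `L`, and mean queues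
grow sublinearly. -/
lemma tendsto_avg_generator_coord {z : State n m} (hz : P.PositiveRecurrent z)
    (a : Arrival n m) :
    Tendsto (fun L : ℕ => P.avg z L (P.generator fun y => (y a : ℝ))) atTop (𝓝 0) := by
  have hlim : Tendsto (fun L : ℕ => (L : ℝ)⁻¹ * (P.step ^ L) (fun y => (y a : ℝ)) z)
      atTop (𝓝 0) := by
    rw [Metric.tendsto_atTop]
    intro ε hε
    obtain ⟨C, hC⟩ := P.exists_step_pow_size_le hz (half_pos hε)
    obtain ⟨N, hN⟩ := exists_nat_gt (C / (ε / 2))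
    refine ⟨N + 1, fun L hL => ?_⟩
    have h0 : 0 ≤ (P.step ^ L) (fun y => (y a : ℝ)) z :=
      P.step_pow_nonneg (fun y => Nat.cast_nonneg _) L z
    have h1 : (P.step ^ L) (fun y => (y a : ℝ)) z ≤ (P.step ^ L) (fun y => (size y : ℝ)) z :=
      P.step_pow_mono L z fun y _ _ => Nat.cast_le.2 (le_const_of_size_le le_rfl a)
    have hLpos : (0 : ℝ) < L := by
      have : 0 < L := by omega
      exact_mod_cast this
    have hNL : (N : ℝ) < L := by
      have : N < L := by omega
      exact_mod_cast this
    have h2 : C < ε / 2 * L := by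
      have := (div_lt_iff₀ (half_pos hε)).1 (hN.trans hNL)
      linarith
    rw [Real.dist_eq, sub_zero, abs_of_nonneg (mul_nonneg (inv_nonneg.2 hLpos.le) h0),
      inv_mul_lt_iff₀ hLpos]
    have := hC L
    linarith
  have h0 : Tendsto (fun L : ℕ => (L : ℝ)⁻¹ * (z a : ℝ)) atTop (𝓝 0) := by
    simpa using (tendsto_inv_atTop_nhds_zero_nat (𝕜 := ℝ)).mul_const (z a : ℝ)
  have h := (hlim.sub h0).const_mul M.uniformRate
  simp only [sub_zero, mul_zero] at h
  refine h.congr fun L => ?_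
  rw [avg_generator]
  ring

lemma profitRate_eq (q : State n m) :
    P.profitRate q = ∑ a, M.revenue a (P.rate q a) - M.s * size q := by
  simp [profitRate, revenue, rate, Fintype.sum_sum_type, size]
  ring

lemma avg_profitRate_le (hs : 0 ≤ M.s)
    (hC : ∀ a, ConcaveOn ℝ (Icc 0 (M.rateMax a)) (M.revenue a)) (z : State n m) {L : ℕ}
    (hL : 0 < L) :
    P.avg z L P.profitRate ≤ ∑ a, M.revenue a (P.avg z L fun q => P.rate q a) := by
  calc P.avg z L P.profitRate ≤ P.avg z L (∑ a, fun q => M.revenue a (P.rate q a)) := by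
        refine P.avg_mono L fun q _ => ?_
        rw [profitRate_eq, Finset.sum_apply]
        exact sub_le_self _ (mul_nonneg hs (Nat.cast_nonneg _))
    _ ≤ _ := by
        rw [map_sum]
        exact Finset.sum_le_sum fun a _ => P.avg_comp_le (hC a) (fun q => P.rate_mem q a) z hL

/-- The expected profits of the uniformized chain grow at most at the rate given by the fluid
problem. -/
lemma exists_sum_step_pow_profitRate_le (hs : 0 ≤ M.s)
    (hC : ∀ a, ConcaveOn ℝ (Icc 0 (M.rateMax a)) (M.revenue a)) {z : State n m}
    (hz0 : P.Accessible 0 z) (hz : P.PositiveRecurrent z) {ε : ℝ} (hε : 0 < ε) :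
    ∃ C : ℝ, ∀ L : ℕ, ∑ l ∈ Finset.range L, (P.step ^ l) P.profitRate z ≤
      (M.fluidValue + ε) * L + C := by
  obtain ⟨κ, hκ, B, hB⟩ := exists_sum_revenue_le_of_nearly_balanced P.rateMax_nonneg hC
  -- At `δ = 0` the two sides differ by `ε > 0`, so small positive `δ` work by continuity.
  obtain ⟨δ, hδ, hδ0, hδ1⟩ : ∃ δ : ℝ, M.fluidValue + δ * B ≤ (1 - δ) * (M.fluidValue + ε) ∧
      0 < δ ∧ δ < 1 := by
    have hcont : Tendsto (fun δ : ℝ => (1 - δ) * (M.fluidValue + ε) - (M.fluidValue + δ * B))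
        (𝓝[>] 0) (𝓝 ((1 - 0) * (M.fluidValue + ε) - (M.fluidValue + 0 * B))) := by
      refine Tendsto.mono_left (Continuous.tendsto ?_ 0) nhdsWithin_le_nhds
      fun_prop
    have h1 := hcont.eventually_const_lt (show (0 : ℝ) < _ by linarith)
    have h2 : ∀ᶠ δ : ℝ in 𝓝[>] 0, δ < 1 :=
      (tendsto_id.mono_left nhdsWithin_le_nhds).eventually_lt_const one_pos
    obtain ⟨δ, h1, h2, h3⟩ := (h1.and (h2.and self_mem_nhdsWithin)).exists
    exact ⟨δ, by linarith, h3, h2⟩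
  have hev : ∀ᶠ L : ℕ in atTop, ∀ a,
      |P.avg z L (P.generator fun y => (y a : ℝ))| ≤ δ * κ := by
    refine eventually_all.2 fun a => ?_
    have h := (P.tendsto_avg_generator_coord hz a).abs
    rw [abs_zero] at h
    exact (h.eventually_lt_const (mul_pos hδ0 hκ)).mono fun L hL => hL.le
  obtain ⟨N, hN⟩ := eventually_atTop.1 hev
  have hlarge : ∀ L : ℕ, N ≤ L → 0 < L →
      ∑ l ∈ Finset.range L, (P.step ^ l) P.profitRate z ≤ (M.fluidValue + ε) * L := by
    intro L hNL hL
    have hLpos : (0 : ℝ) < L := Nat.cast_pos.2 hL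
    have h1 := hB δ ⟨hδ0, hδ1⟩ (fun a => P.avg z L fun q => P.rate q a)
      (fun i j => P.avg z L fun q => P.matchRate q i j)
      (fun a => P.avg_mem_Icc hL fun q => P.rate_mem q a)
      (fun i j => P.avg_nonneg L fun q => P.matchRate_nonneg q i j)
      (fun i j hij => P.avg_eq_zero L fun q _ => Finset.sum_eq_zero fun k _ => by
        simp [(P.matching_mem q k).2.2 i j hij])
      (fun a => by rw [avg_balance]; exact hN L hNL a)
      (fun a ha => by
        rw [avg_balance]
        exact P.avg_eq_zero L fun q hq => P.generator_coord_eq_zero hz0 hz hq ha)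
    have h2 := P.avg_profitRate_le hs hC z hL
    have h3 : P.avg z L P.profitRate ≤ M.fluidValue + ε :=
      h2.trans (le_of_mul_le_mul_left (h1.trans hδ) (sub_pos.2 hδ1))
    rw [avg_apply, inv_mul_le_iff₀ hLpos] at h3
    linarith
  -- The constant absorbs the finitely many horizons `L ≤ N`, among them `L = 0`.
  refine ⟨∑ L ∈ Finset.range (N + 1),
    |∑ l ∈ Finset.range L, (P.step ^ l) P.profitRate z - (M.fluidValue + ε) * L|, fun L => ?_⟩
  by_cases hL : L < N + 1
  · have h1 := Finset.single_le_sum (f := fun L : ℕ =>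
      |∑ l ∈ Finset.range L, (P.step ^ l) P.profitRate z - (M.fluidValue + ε) * L|)
      (fun _ _ => abs_nonneg _) (Finset.mem_range.2 hL)
    have h2 := (le_abs_self _).trans h1
    linarith
  · have h1 := hlarge L (by omega) (by omega)
    exact h1.trans (le_add_of_nonneg_right (Finset.sum_nonneg fun _ _ => abs_nonneg _))

end Policy
end System
end TwoSided

/-! ### Exponential generating functions and Poisson averages -/

namespace TwoSided

/-- The exponential generating function of a sequence. -/
noncomputable def expSum (a : ℕ → ℝ) (t : ℝ) : ℝ := ∑' l : ℕ, t ^ l / (l.factorial : ℝ) * a l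

/-- Growth at most like the powers of two, so that the exponential generating function is entire. -/
def ExpGrowth (a : ℕ → ℝ) : Prop := ∃ C, ∀ l, |a l| ≤ C * 2 ^ l

lemma ExpGrowth.norm_le {a : ℕ → ℝ} {C : ℝ} (hC : ∀ l, |a l| ≤ C * 2 ^ l) {t R : ℝ}
    (ht : |t| ≤ R) (l : ℕ) :
    ‖t ^ l / (l.factorial : ℝ) * a l‖ ≤ C * ((2 * R) ^ l / (l.factorial : ℝ)) := by
  have hf : (0 : ℝ) < l.factorial := Nat.cast_pos.2 l.factorial_pos
  rw [norm_mul, norm_div, norm_pow, Real.norm_eq_abs, Real.norm_eq_abs, Real.norm_eq_abs,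
    abs_of_pos hf]
  calc |t| ^ l / l.factorial * |a l| ≤ R ^ l / l.factorial * (C * 2 ^ l) := by
        have : 0 ≤ R := (abs_nonneg t).trans ht
        gcongr
        exact hC l
    _ = _ := by rw [mul_pow]; ring

lemma ExpGrowth.summable_norm {a : ℕ → ℝ} (ha : ExpGrowth a) (t : ℝ) :
    Summable fun l : ℕ => ‖t ^ l / (l.factorial : ℝ) * a l‖ := by
  obtain ⟨C, hC⟩ := ha
  exact Summable.of_nonneg_of_le (fun _ => norm_nonneg _) (ExpGrowth.norm_le hC le_rfl)
    ((Real.summable_pow_div_factorial (2 * |t|)).mul_left C)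

lemma ExpGrowth.summable {a : ℕ → ℝ} (ha : ExpGrowth a) (t : ℝ) :
    Summable fun l : ℕ => t ^ l / (l.factorial : ℝ) * a l := (ha.summable_norm t).of_norm

lemma ExpGrowth.shift {a : ℕ → ℝ} (ha : ExpGrowth a) : ExpGrowth fun l => a (l + 1) := by
  obtain ⟨C, hC⟩ := ha
  exact ⟨C * 2, fun l => (hC (l + 1)).trans_eq (by ring)⟩

lemma expSum_const (c t : ℝ) : expSum (fun _ => c) t = c * Real.exp t := by
  rw [Real.exp_eq_exp_ℝ, NormedSpace.exp_eq_tsum_div, expSum, tsum_mul_right, mul_comm]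

lemma expSum_zero (a : ℕ → ℝ) : expSum a 0 = a 0 := by
  rw [expSum, tsum_eq_single 0 fun l hl => by simp [hl]]
  simp

/-- Termwise differentiation, with a summable bound on a ball around zero that contains `t`. -/
lemma ExpGrowth.hasDerivAt {a : ℕ → ℝ} (ha : ExpGrowth a) (t : ℝ) :
    HasDerivAt (expSum a) (expSum (fun l => a (l + 1)) t) t := by
  obtain ⟨C, hC⟩ := ha.shift
  set R := |t| + 1
  set g' : ℕ → ℝ → ℝ := fun l y => (l : ℝ) * y ^ (l - 1) / (l.factorial : ℝ) * a l with hg'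
  set u : ℕ → ℝ := fun l => Nat.casesOn l 0 fun l => C * ((2 * R) ^ l / (l.factorial : ℝ))
  have hg's : ∀ l y, g' (l + 1) y = y ^ l / (l.factorial : ℝ) * a (l + 1) := by
    intro l y
    have : (l : ℝ) + 1 ≠ 0 := by positivity
    simp only [hg', Nat.factorial_succ, Nat.add_sub_cancel]
    push_cast
    rw [mul_div_mul_left _ _ this]
  have hu : Summable u :=
    (summable_nat_add_iff 1).1 ((Real.summable_pow_div_factorial (2 * R)).mul_left C)
  have hball : t ∈ Metric.ball (0 : ℝ) R := by simp [R]
  have h := hasDerivAt_tsum_of_isPreconnected (g := fun (l : ℕ) y => y ^ l / (l.factorial : ℝ) * a l)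
    (g' := g') hu Metric.isOpen_ball (convex_ball (0 : ℝ) R).isPreconnected
    (fun l y _ => ((hasDerivAt_pow l y).div_const _).mul_const _)
    (fun l y hy => by
      cases l with
      | zero => simp [hg', u]
      | succ l =>
        rw [hg's]
        exact ExpGrowth.norm_le hC (by simpa using (mem_ball_zero_iff.1 hy).le) l) hball (ha.summable t) hball
  have hsum : ∑' l, g' l t = expSum (fun l => a (l + 1)) t := by
    have hs : Summable fun l => g' l t := by
      refine (summable_nat_add_iff 1).1 ?_
      simp only [hg's]
      exact ha.shift.summable t
    rw [hs.tsum_eq_zero_add]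
    simp [hg's, expSum]
    simp [hg']
  rw [← hsum]
  exact h

/-- The left side is the mean of `a` at a Poisson variable with parameter `x`, whose own mean is
`x`. -/
lemma exp_mul_expSum_le {a : ℕ → ℝ} (ha : ExpGrowth a) {α C : ℝ} (h : ∀ l : ℕ, a l ≤ α * l + C)
    {x : ℝ} (hx : 0 ≤ x) : Real.exp (-x) * expSum a x ≤ α * x + C := by
  have hc : HasSum (fun l : ℕ => x ^ l / (l.factorial : ℝ)) (Real.exp x) := by
    rw [Real.exp_eq_exp_ℝ]
    exact NormedSpace.expSeries_div_hasSum_exp x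
  have hl : HasSum (fun l : ℕ => x ^ l / (l.factorial : ℝ) * l) (x * Real.exp x) := by
    rw [← hasSum_nat_add_iff' 1]
    simp only [Finset.sum_range_one, Nat.cast_zero, mul_zero, sub_zero]
    refine (hc.mul_left x).congr_fun ?_
    intro l
    have : (l : ℝ) + 1 ≠ 0 := by positivity
    rw [Nat.factorial_succ]
    push_cast
    field_simp
    ring
  have h2 := (hl.mul_left α).add (hc.mul_left C)
  have h3 : expSum a x ≤ α * (x * Real.exp x) + C * Real.exp x := by
    rw [← h2.tsum_eq]
    refine (ha.summable x).tsum_le_tsum (fun l => ?_) h2.summable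
    have := mul_le_mul_of_nonneg_left (h l)
      (show 0 ≤ x ^ l / (l.factorial : ℝ) by positivity)
    linarith
  calc _ ≤ Real.exp (-x) * (α * (x * Real.exp x) + C * Real.exp x) :=
        mul_le_mul_of_nonneg_left h3 (Real.exp_pos _).le
    _ = (Real.exp (-x) * Real.exp x) * (α * x + C) := by ring
    _ = _ := by rw [← Real.exp_add]; simp

/-- This is the Cauchy product of the series of `expSum b` and of the exponential. It turns binomial
expansions of generator powers into Poisson mixtures. -/
lemma expSum_antidiagonal {b : ℕ → ℝ} (hb : ExpGrowth b) (c t : ℝ) :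
    expSum (fun l => c ^ l * ∑ p ∈ Finset.HasAntidiagonal.antidiagonal l,
      (l.choose p.1 : ℝ) * ((-1) ^ p.2 * b p.1)) t = Real.exp (-(c * t)) * expSum b (c * t) := by
  have h1 : ExpGrowth fun _ => 1 := ⟨1, fun l => by simpa using one_le_pow₀ one_le_two⟩
  have he : Real.exp (-(c * t)) = expSum (fun _ => 1) (-(c * t)) := by rw [expSum_const, one_mul]
  rw [he, mul_comm, expSum, expSum, expSum,
    tsum_mul_tsum_eq_tsum_sum_antidiagonal_of_summable_norm (hb.summable_norm _)
      (h1.summable_norm _)]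
  refine tsum_congr fun l => ?_
  rw [Finset.mul_sum, Finset.mul_sum]
  refine Finset.sum_congr rfl fun p hp => ?_
  have hl : p.1 + p.2 = l := Finset.HasAntidiagonal.mem_antidiagonal.1 hp
  subst hl
  have hch : ((p.1 + p.2).choose p.1 : ℝ) * p.1.factorial * p.2.factorial =
      (p.1 + p.2).factorial := by
    rw [Nat.choose_symm_add]
    exact_mod_cast Nat.add_choose_mul_factorial_mul_factorial p.1 p.2
  have hf1 : (p.1.factorial : ℝ) ≠ 0 := Nat.cast_ne_zero.2 p.1.factorial_ne_zero
  have hf2 : (p.2.factorial : ℝ) ≠ 0 := Nat.cast_ne_zero.2 p.2.factorial_ne_zero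
  have hf : ((p.1 + p.2).factorial : ℝ) ≠ 0 := Nat.cast_ne_zero.2 (Nat.factorial_ne_zero _)
  rw [neg_pow (c * t), mul_pow c t, mul_pow c t, pow_add, pow_add]
  field_simp
  rw [← hch]
  ring

/-! ### Return to continuous time -/

namespace System
namespace Policy

variable {n m : ℕ} {M : System n m} (P : M.Policy)

lemma abs_step_pow_le {f : State n m → ℝ} {D : ℝ} (l : ℕ) (q : State n m)
    (h : ∀ y, size y ≤ size q + l → |f y| ≤ D) : |(P.step ^ l) f q| ≤ D := by
  have h1 := P.step_pow_mono (f := f) (g := D • 1) l q fun y _ hy => by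
    simpa using (abs_le.1 (h y hy)).2
  have h2 := P.step_pow_mono (f := (-D) • 1) (g := f) l q fun y _ hy => by
    simpa using (abs_le.1 (h y hy)).1
  rw [map_smul, step_pow_one] at h1 h2
  exact abs_le.2 ⟨by simpa using h2, by simpa using h1⟩

lemma expGrowth_step_pow {f : State n m → ℝ} {B s : ℝ} (hs : 0 ≤ s)
    (hf : ∀ y, |f y| ≤ B + s * size y) (q : State n m) : ExpGrowth fun l => (P.step ^ l) f q := by
  have hB : 0 ≤ B := by simpa [size] using (abs_nonneg _).trans (hf 0)
  refine ⟨B + s * size q + s, fun l => ?_⟩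
  have h1 : |(P.step ^ l) f q| ≤ B + s * (size q + l : ℕ) :=
    P.abs_step_pow_le l q fun y hy => (hf y).trans (by gcongr)
  have h2 : (1 : ℝ) ≤ 2 ^ l := one_le_pow₀ one_le_two
  have h3 : (l : ℝ) ≤ 2 ^ l := by exact_mod_cast Nat.lt_two_pow_self.le
  push_cast at h1
  have h4 : 0 ≤ B + s * size q := by positivity
  nlinarith [mul_le_mul_of_nonneg_left h2 h4, mul_le_mul_of_nonneg_left h3 hs]

lemma abs_single_le (y x : State n m) : |(Pi.single y 1 : State n m → ℝ) x| ≤ 1 + 0 * size x := by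
  rw [Pi.single_apply]
  split_ifs <;> simp

/-- Binomial theorem for `uniformRate ^ l • (step - 1) ^ l`; `step` commutes with the identity. -/
lemma generator_iterate (f : State n m → ℝ) (q : State n m) (l : ℕ) :
    (P.generator^[l] f) q = M.uniformRate ^ l * ∑ p ∈ Finset.HasAntidiagonal.antidiagonal l,
      (l.choose p.1 : ℝ) * ((-1) ^ p.2 * (P.step ^ p.1) f q) := by
  have h1 : P.generator^[l] f = (P.generatorMap ^ l) f := by
    rw [Module.End.coe_pow]; rfl
  rw [h1, generatorMap_eq, smul_pow,
    ((Commute.one_right P.step).smul_right (-1 : ℝ)).add_pow']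
  simp only [LinearMap.smul_apply, Pi.smul_apply, LinearMap.sum_apply, Finset.sum_apply,
    smul_eq_mul]
  congr 1
  refine Finset.sum_congr rfl fun p _ => ?_
  rw [smul_pow, one_pow, mul_smul_comm, mul_one, ← Nat.cast_smul_eq_nsmul ℝ]
  simp

lemma transProb_eq (t : ℝ) (q y : State n m) :
    P.transProb t q y = Real.exp (-(M.uniformRate * t)) *
      expSum (fun l => (P.step ^ l) (Pi.single y 1) q) (M.uniformRate * t) := by
  rw [← expSum_antidiagonal (P.expGrowth_step_pow le_rfl (abs_single_le y) q)]
  simp only [transProb, expSum, generator_iterate]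

lemma hasSum_step_pow (f : State n m → ℝ) (l : ℕ) (q : State n m) :
    HasSum (fun y => (P.step ^ l) (Pi.single y 1) q * f y) ((P.step ^ l) f q) := by
  rw [P.step_pow_eq_sum f (le_refl (size q + l))]
  refine hasSum_sum_of_ne_finset_zero fun y hy => ?_
  have : (P.step ^ l) (Pi.single y 1) q = (P.step ^ l) 0 q :=
    P.step_pow_congr l q fun x _ hx => by
      have hxy : x ≠ y := by
        rintro rfl
        exact hy (Finset.mem_Iic.2 (le_const_of_size_le hx))
      simp [hxy]
  rw [this, map_zero]
  simp

/-- Expectations along the continuous-time chain, by uniformization. -/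
lemma tsum_transProb_mul {f : State n m → ℝ} {B s : ℝ} (hs : 0 ≤ s)
    (hf : ∀ y, |f y| ≤ B + s * size y) (t : ℝ) (q : State n m) :
    ∑' y, P.transProb t q y * f y = Real.exp (-(M.uniformRate * t)) *
      expSum (fun l => (P.step ^ l) f q) (M.uniformRate * t) := by
  set x := M.uniformRate * t
  have hterm : ∀ y, P.transProb t q y * f y = Real.exp (-x) *
      ∑' l : ℕ, x ^ l / (l.factorial : ℝ) * ((P.step ^ l) (Pi.single y 1) q * f y) := by
    intro y
    rw [transProb_eq, expSum, mul_assoc, ← tsum_mul_right]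
    simp only [mul_assoc, x]
  simp only [hterm]
  rw [tsum_mul_left]
  congr 1
  have hnorm : ∀ l y, ‖x ^ l / (l.factorial : ℝ) * ((P.step ^ l) (Pi.single y 1) q * f y)‖ =
      |x ^ l / (l.factorial : ℝ)| * ((P.step ^ l) (Pi.single y 1) q * |f y|) := by
    intro l y
    have : 0 ≤ (P.step ^ l) (Pi.single y 1) q := P.step_pow_nonneg (fun z => by
      rw [Pi.single_apply]; split_ifs <;> simp) l q
    rw [norm_mul, norm_mul, Real.norm_eq_abs, Real.norm_eq_abs, Real.norm_eq_abs,
      abs_of_nonneg this]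
  have habs : ExpGrowth fun l => (P.step ^ l) (fun y => |f y|) q :=
    P.expGrowth_step_pow hs (fun y => by rw [abs_abs]; exact hf y) q
  -- Absolute summability, needed to exchange the sums over steps and states; the weights are
  -- nonnegative, so it reduces to the growth bound for `|f|`.
  have hsum : Summable (Function.uncurry fun (l : ℕ) (y : State n m) =>
      x ^ l / (l.factorial : ℝ) * ((P.step ^ l) (Pi.single y 1) q * f y)) := by
    refine Summable.of_norm ((summable_prod_of_nonneg fun _ => norm_nonneg _).2 ⟨fun l => ?_, ?_⟩)
    · simp only [Function.uncurry, hnorm]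
      exact (P.hasSum_step_pow _ l q).summable.mul_left _
    · simp only [Function.uncurry, hnorm, tsum_mul_left, (P.hasSum_step_pow _ _ q).tsum_eq]
      refine (habs.summable_norm x).congr fun l => ?_
      rw [norm_mul, Real.norm_eq_abs, Real.norm_eq_abs,
        abs_of_nonneg (P.step_pow_nonneg (fun y => abs_nonneg (f y)) l q)]
  rw [hsum.tsum_comm, expSum]
  refine tsum_congr fun l => ?_
  rw [tsum_mul_left, (P.hasSum_step_pow f l q).tsum_eq]

lemma expGrowth_sum {a : ℕ → ℝ} (ha : ExpGrowth a) :
    ExpGrowth fun L => ∑ l ∈ Finset.range L, a l := by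
  obtain ⟨C, hC⟩ := ha
  have hC0 : 0 ≤ C := by simpa using (abs_nonneg _).trans (hC 0)
  refine ⟨C, fun L => ?_⟩
  have h1 : |∑ l ∈ Finset.range L, a l| ≤ ∑ l ∈ Finset.range L, C * 2 ^ l :=
    (Finset.abs_sum_le_sum_abs _ _).trans (Finset.sum_le_sum fun l _ => hC l)
  refine h1.trans ?_
  rw [← Finset.mul_sum, geom_sum_eq (by norm_num)]
  refine mul_le_mul_of_nonneg_left ?_ hC0
  norm_num

/-- The expected total profit until time `T` in terms of the uniformized chain. -/
lemma integral_expectedProfitRate {B s : ℝ} (hs : 0 ≤ s)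
    (hf : ∀ y, |P.profitRate y| ≤ B + s * size y) (q : State n m) (T : ℝ) :
    ∫ t in (0 : ℝ)..T, P.expectedProfitRate q t =
      M.uniformRate⁻¹ * (Real.exp (-(M.uniformRate * T)) *
        expSum (fun L => ∑ l ∈ Finset.range L, (P.step ^ l) P.profitRate q)
          (M.uniformRate * T)) := by
  have hu := P.uniformRate_pos.ne'
  set u := M.uniformRate
  have hr : ExpGrowth fun l => (P.step ^ l) P.profitRate q := P.expGrowth_step_pow hs hf q
  have hS := expGrowth_sum hr
  set S : ℕ → ℝ := fun L => ∑ l ∈ Finset.range L, (P.step ^ l) P.profitRate q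
  have hfun : P.expectedProfitRate q = fun t =>
      Real.exp (-(u * t)) * expSum (fun l => (P.step ^ l) P.profitRate q) (u * t) :=
    funext fun t => P.tsum_transProb_mul hs hf t q
  have hlin : ∀ t, HasDerivAt (fun t : ℝ => u * t) u t := fun t => by
    simpa using (hasDerivAt_id t).const_mul u
  have hd : ∀ {a : ℕ → ℝ}, ExpGrowth a → ∀ t, HasDerivAt
      (fun t => Real.exp (-(u * t)) * expSum a (u * t))
      (Real.exp (-(u * t)) * -u * expSum a (u * t) +
        Real.exp (-(u * t)) * (expSum (fun l => a (l + 1)) (u * t) * u)) t := fun ha t =>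
    ((hlin t).neg.exp).mul ((ha.hasDerivAt (u * t)).comp t (hlin t))
  -- Differentiating a Poisson average of `S` gives `u` times the average of `S (l + 1) - S l`,
  -- which is the expected profit at step `l`.
  have hder : ∀ t, HasDerivAt (fun t => u⁻¹ * (Real.exp (-(u * t)) * expSum S (u * t)))
      (P.expectedProfitRate q t) t := by
    intro t
    refine ((hd hS t).const_mul u⁻¹).congr_deriv ?_
    have : expSum (fun l => (P.step ^ l) P.profitRate q) (u * t) =
        expSum (fun l => S (l + 1)) (u * t) - expSum S (u * t) := by
      rw [expSum, expSum, expSum,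
        ← (hS.shift.summable (u * t)).tsum_sub (hS.summable (u * t))]
      refine tsum_congr fun l => ?_
      rw [← mul_sub]
      simp only [S, Finset.sum_range_succ, add_sub_cancel_left]
    rw [hfun]
    simp only [this]
    field_simp
    ring
  have hcont : Continuous (P.expectedProfitRate q) := by
    rw [hfun]
    exact continuous_iff_continuousAt.2 fun t => (hd hr t).continuousAt
  rw [intervalIntegral.integral_eq_sub_of_hasDerivAt (fun t _ => hder t)
    (hcont.intervalIntegrable 0 T)]
  simp [expSum_zero, S]

lemma longRunProfit_le {B s : ℝ} (hs : 0 ≤ s)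
    (hf : ∀ y, |P.profitRate y| ≤ B + s * size y) {q : State n m} {α : ℝ}
    (h : ∀ ε > 0, ∃ C : ℝ, ∀ L : ℕ, ∑ l ∈ Finset.range L, (P.step ^ l) P.profitRate q ≤
      (α + ε) * L + C) : P.longRunProfit q ≤ (α : EReal) := by
  refine le_of_forall_gt fun c hc => ?_
  obtain ⟨b, hb, hbc⟩ := EReal.lt_iff_exists_real_btwn.1 hc
  have hαb : α < b := EReal.coe_lt_coe_iff.1 hb
  refine lt_of_le_of_lt ?_ hbc
  -- Half of the gap between `α` and `b` serves as `ε`; for large `T` the other half absorbs the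
  -- constant `C / uniformRate`.
  obtain ⟨C, hC⟩ := h ((b - α) / 2) (by linarith)
  have hu := P.uniformRate_pos
  refine limsup_le_of_le (h := ?_)
  filter_upwards [eventually_gt_atTop 0,
    eventually_ge_atTop (C / M.uniformRate / ((b - α) / 2))] with T hT hTC
  refine EReal.coe_le_coe_iff.2 ?_
  rw [div_le_iff₀ hT, P.integral_expectedProfitRate hs hf, inv_mul_le_iff₀ hu]
  refine (exp_mul_expSum_le (expGrowth_sum (P.expGrowth_step_pow hs hf q)) hC
    (mul_nonneg hu.le hT.le)).trans ?_
  rw [div_le_iff₀ (by linarith), div_le_iff₀ hu] at hTC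
  nlinarith

end Policy
end System
end TwoSided

theorem mainTheorem5 {n m : ℕ} (M : TwoSided.System n m)
    (hlamMax : ∀ j, 0 ≤ M.lamMax j) (hmuMax : ∀ i, 0 ≤ M.muMax i) (hs : 0 ≤ M.s)
    (hF_anti : ∀ j, StrictAntiOn (M.F j) (Set.Ioc 0 (M.lamMax j)))
    (hF_diff : ∀ j, ContDiffOn ℝ 2 (M.F j) (Set.Ioc 0 (M.lamMax j)))
    (hG_mono : ∀ i, StrictMonoOn (M.G i) (Set.Ioc 0 (M.muMax i)))
    (hG_diff : ∀ i, ContDiffOn ℝ 2 (M.G i) (Set.Ioc 0 (M.muMax i)))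
    (hF_concave : ∀ j, ConcaveOn ℝ (Set.Icc 0 (M.lamMax j)) (fun r => r * M.F j r))
    (hG_convex : ∀ i, ConvexOn ℝ (Set.Icc 0 (M.muMax i)) (fun r => r * M.G i r)) :
    IsLUB (M.fluidObjective '' M.fluidFeasible) M.fluidValue ∧
      ∀ P : M.Policy, P.Stable → ∀ q₀ ∈ P.zeroClass,
        P.longRunProfit q₀ ≤ (M.fluidValue : EReal) := by
  have hmax : ∀ a, 0 ≤ M.rateMax a := fun a => by
    cases a with
    | inl i => exact hmuMax i
    | inr j => exact hlamMax j
  have hC := TwoSided.System.concaveOn_revenue hF_concave hG_convex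
  refine ⟨TwoSided.System.isLUB_fluidValue hmax hC, fun P hP q₀ hq₀ => ?_⟩
  obtain ⟨B, -, hB⟩ := TwoSided.System.exists_abs_revenue_le hmax hC
  refine P.longRunProfit_le (B := B) hs (fun y => ?_) fun ε hε =>
    P.exists_sum_step_pow_profitRate_le hs hC hq₀.1 (hP q₀ hq₀) hε
  rw [P.profitRate_eq]
  refine (abs_sub _ _).trans (add_le_add (hB _ fun a => P.rate_mem y a) ?_)
  rw [abs_of_nonneg (mul_nonneg hs (Nat.cast_nonneg _))]
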